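/- **Setting.** Let $\mathbb N=\{1,2,\dots\}$; for finite nonempty $E,F\subset\mathbb N$ write $E<F$ if $\max E<\min F$. The Schreier families $\mathcal S_\alpha$ ($\alpha<\omega_1$) of finite subsets of $\mathbb N$ are defined by $\mathcal S_0=\{F:|F|\le 1\}$; $$\mathcal S_{\beta+1}=\Big\{\bigcup_{i=1}^d S_i:\ d\in\mathbb N,\ S_1<\dots<S_d \text{ nonempty sets in }\mathcal S_\beta,\ d\le\min S_1\Big\}\cup\{\emptyset\};$$ and, for a nonzero limit ordinal $\lambda$, $$\mathcal S_\lambda=\{F\neq\emptyset:\ F\in\mathcal S_{\beta_n+1}\text{ and } n\le\min F\text{ for some }n\in\mathbb N\}\cup\{\emptyset\},$$ where $(\beta_n+1)_{n\ge 1}$ is a fixed strictly increasing sequence of successor ordinals (depending on $\lambda$) converging to $\lambda$ with $\mathcal S_{\beta_n}\subset\mathcal S_{\beta_{n+1}}$ for all $n$. The theorem holds for every such choice of sequences. Let $0<\theta\le\frac12$ and let $\mathcal F$ be one of these families. On the real space $c_{00}$ of finitely supported sequences, with unit vectors $(e_i)_{i\ge1}$, let $\|x\|_0=\max_i|x_i|$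 and $$\|x\|_{n+1}=\max\Big\{\|x\|_n,\ \sup\theta\sum_{i=1}^d\|E_ix\|_n\Big\},$$ the supremum being over all $d$ and all finite nonempty sets $E_1<\dots<E_d$ with $\{\min E_1,\dots,\min E_d\}\in\mathcal F$, where $Ex$ is the restriction of $x$ to the coordinates in $E$. Then $\|x\|=\sup_n\|x\|_n$ is a norm, $T[\theta,\mathcal F]$ denotes the completion of $c_{00}$ under it, and every $x\in T[\theta,\mathcal F]$ has a unique (unconditionally convergent) expansion $x=\sum_{i=1}^\infty a_ie_i$ with real $a_i$. **Theorem.** Let $\theta^{-1}\ge2$ be an integer, let $1\le\alpha<\omega_1$, let $\mathbb S$ be the unit sphere of $T[\theta,\mathcal S_\alpha]$, and let $U:\mathbb S\to\mathbb S$ be a surjective (not necessarily linear) isometry. 1. If $\alpha=1$, there are signs $\varepsilon_i\in\{-1,1\}$ ($i\in\mathbb N$) and a permutation $\pi$ of $\{1,\dots,\theta^{-1}\}$ such that $$U\Big(\sum_{i=1}^\infty a_ie_i\Big)=\sum_{i=1}^{\theta^{-1}}\varepsilon_ia_ie_{\pi(i)}+\sum_{i=\theta^{-1}+1}^\infty\varepsilon_ia_ie_i\qquad\text{for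 every }\sum_{i=1}^\infty a_ie_i\in\mathbb S.$$ 2. If $1<\alpha<\omega_1$, there are signs $\varepsilon_i\in\{-1,1\}$ ($i\in\mathbb N$) such that $$U\Big(\sum_{i=1}^\infty a_ie_i\Big)=\sum_{i=1}^\infty\varepsilon_ia_ie_i\qquad\text{for every }\sum_{i=1}^\infty a_ie_i\in\mathbb S.$$ Consequently, in both cases, $U$ is the restriction to $\mathbb S$ of a surjective linear isometry of $T[\theta,\mathcal S_\alpha]$ onto itself (a positive answer to Tingley's problem for surjective isometries of $\mathbb S$ onto itself). -/

import Mathlib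

open scoped Ordinal

noncomputable section

namespace Tsirelson

/-- `E < F` for finite sets of positive integers: every element of `E` is smaller than every
element of `F`. -/
def Before (E F : Finset ℕ+) : Prop := ∀ a ∈ E, ∀ b ∈ F, a < b

/-- `E 0 < E 1 < ⋯ < E (d - 1)`, all of them nonempty. -/
structure Consecutive {d : ℕ} (E : Fin d → Finset ℕ+) : Prop where
  nonempty : ∀ i, (E i).Nonempty
  before : ∀ i j, i < j → Before (E i) (E j)

/-- The Schreier families. For a limit ordinal `l`, the prescribed sequence of successor ordinals
converging to `l` is `n ↦ β l n + 1`, `n = 1, 2, …`; the conditions on `β` are in `IsLadder`. -/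
def schreier (β : Ordinal.{0} → ℕ+ → Ordinal.{0}) (α : Ordinal.{0}) : Set (Finset ℕ+) :=
  Ordinal.limitRecOn α
    {G | G.card ≤ 1}
    (fun _ S => {G | ∃ (d : ℕ) (B : Fin d → Finset ℕ+), Consecutive B ∧ (∀ i, B i ∈ S) ∧
      (∀ k : ℕ+, k ∈ G → d ≤ (k : ℕ)) ∧ G = Finset.univ.biUnion B} ∪ {∅})
    (fun l _ S => {G | ∃ (n : ℕ+) (h : β l n + 1 < l), G ∈ S (β l n + 1) h ∧ ∀ k : ℕ+, k ∈ G → n ≤ k} ∪ {∅})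

theorem schreier_zero (β : Ordinal.{0} → ℕ+ → Ordinal.{0}) :
    schreier β 0 = {G | G.card ≤ 1} :=
  Ordinal.limitRecOn_zero ..

theorem schreier_add_one (β : Ordinal.{0} → ℕ+ → Ordinal.{0}) (α : Ordinal.{0}) :
    schreier β (α + 1) = {G | ∃ (d : ℕ) (B : Fin d → Finset ℕ+), Consecutive B ∧
      (∀ i, B i ∈ schreier β α) ∧ (∀ k : ℕ+, k ∈ G → d ≤ (k : ℕ)) ∧ G = Finset.univ.biUnion B} ∪ {∅} :=
  Ordinal.limitRecOn_add_one ..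

theorem schreier_limit (β : Ordinal.{0} → ℕ+ → Ordinal.{0}) (l : Ordinal.{0})
    (hl : Order.IsSuccLimit l) :
    schreier β l = {G | ∃ (n : ℕ+) (_ : β l n + 1 < l), G ∈ schreier β (β l n + 1) ∧
      ∀ k : ℕ+, k ∈ G → n ≤ k} ∪ {∅} :=
  Ordinal.limitRecOn_limit _ _ _ _ hl

/-- The admissible choices of sequences at countable limit ordinals: for each nonzero limit
ordinal `l < ω₁` the successor ordinals `β l n + 1` lie below `l`, strictly increase, and converge
to `l`, and the Schreier families of orders `β l n` increase with `n`. -/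
structure IsLadder (β : Ordinal.{0} → ℕ+ → Ordinal.{0}) : Prop where
  lt : ∀ l < ω₁, Order.IsSuccLimit l → ∀ n, β l n + 1 < l
  strictMono : ∀ l < ω₁, Order.IsSuccLimit l → StrictMono (β l)
  cofinal : ∀ l < ω₁, Order.IsSuccLimit l → ∀ γ < l, ∃ n, γ < β l n + 1
  subset : ∀ l < ω₁, Order.IsSuccLimit l → ∀ n, schreier β (β l n) ⊆ schreier β (β l (n + 1))

/-- The projection `E x` of a finitely supported vector `x` onto the coordinates in `E`. -/
def proj (E : Finset ℕ+) (x : ℕ+ →₀ ℝ) : ℕ+ →₀ ℝ := x.filter (fun k => k ∈ E)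

/-- `E 0 < ⋯ < E (d - 1)` and the set of minima of the `E i` belongs to `F`. -/
def Admissible (F : Set (Finset ℕ+)) {d : ℕ} (E : Fin d → Finset ℕ+) : Prop :=
  ∃ h : Consecutive E, Finset.univ.image (fun i => (E i).min' (h.nonempty i)) ∈ F

/-- The values `θ * ∑ i, p (E i x)` over all `F`-admissible `E`. -/
def values (θ : ℝ) (F : Set (Finset ℕ+)) (p : (ℕ+ →₀ ℝ) → ℝ) (x : ℕ+ →₀ ℝ) : Set ℝ :=
  {r | ∃ (d : ℕ) (E : Fin d → Finset ℕ+), Admissible F E ∧ r = θ * ∑ i, p (proj (E i) x)}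

/-- The `n`-th approximating norm on `c₀₀`. -/
def normSeq (θ : ℝ) (F : Set (Finset ℕ+)) : ℕ → (ℕ+ →₀ ℝ) → ℝ
  | 0, x => ⨆ k, |x k|
  | n + 1, x => max (normSeq θ F n x) (sSup (values θ F (normSeq θ F n) x))

/-- The norm of `T[θ, F]` on `c₀₀`. -/
def tsirelsonNorm (θ : ℝ) (F : Set (Finset ℕ+)) (x : ℕ+ →₀ ℝ) : ℝ := ⨆ n, normSeq θ F n x

/-! Verification that `tsirelsonNorm θ F` is a norm if `0 < θ ≤ 1 / 2`. -/

/-- The `ℓ₁`-norm on `c₀₀`. -/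
def l1 (x : ℕ+ →₀ ℝ) : ℝ := ∑ k ∈ x.support, |x k|

theorem l1_nonneg (x : ℕ+ →₀ ℝ) : 0 ≤ l1 x := Finset.sum_nonneg fun _ _ => abs_nonneg _

theorem proj_add (E : Finset ℕ+) (x y : ℕ+ →₀ ℝ) : proj E (x + y) = proj E x + proj E y :=
  Finsupp.filter_add

theorem proj_smul (E : Finset ℕ+) (c : ℝ) (x : ℕ+ →₀ ℝ) : proj E (c • x) = c • proj E x :=
  Finsupp.filter_smul

theorem abs_le_l1 (x : ℕ+ →₀ ℝ) (k : ℕ+) : |x k| ≤ l1 x := by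
  by_cases hk : k ∈ x.support
  · exact Finset.single_le_sum (f := fun k => |x k|) (fun _ _ => abs_nonneg _) hk
  · rw [Finsupp.notMem_support_iff] at hk
    simpa [hk] using l1_nonneg x

theorem l1_proj (E : Finset ℕ+) (x : ℕ+ →₀ ℝ) :
    l1 (proj E x) = ∑ k ∈ x.support, if k ∈ E then |x k| else 0 := by
  unfold l1 proj
  rw [Finsupp.support_filter, Finset.sum_filter]
  refine Finset.sum_congr rfl fun k _ => ?_
  split_ifs with h
  · rw [Finsupp.filter_apply_pos _ _ h]
  · rfl

theorem sum_l1_proj_le {d : ℕ} {E : Fin d → Finset ℕ+} (hE : Consecutive E) (x : ℕ+ →₀ ℝ) :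
    ∑ i, l1 (proj (E i) x) ≤ l1 x := by
  simp_rw [l1_proj]
  rw [Finset.sum_comm]
  refine Finset.sum_le_sum fun k _ => ?_
  by_cases h : ∃ i, k ∈ E i
  · obtain ⟨i, hi⟩ := h
    rw [Finset.sum_eq_single i]
    · simp [hi]
    · intro j _ hj
      rw [if_neg]
      intro hkj
      rcases lt_or_gt_of_ne hj with h | h
      · exact lt_irrefl _ (hE.before _ _ h k hkj k hi)
      · exact lt_irrefl _ (hE.before _ _ h k hi k hkj)
    · simp
  · push Not at h
    simp [h]

/-- A seminorm dominated by the `ℓ₁`-norm. -/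
structure IsGood (p : (ℕ+ →₀ ℝ) → ℝ) : Prop where
  nonneg : ∀ x, 0 ≤ p x
  le_l1 : ∀ x, p x ≤ l1 x
  smul : ∀ (c : ℝ) x, p (c • x) = |c| * p x
  add_le : ∀ x y, p (x + y) ≤ p x + p y

theorem isGood_iSup {ι : Type} [Nonempty ι] {p : ι → (ℕ+ →₀ ℝ) → ℝ} (hp : ∀ n, IsGood (p n)) :
    IsGood (fun x => ⨆ n, p n x) := by
  have hb : ∀ x, BddAbove (Set.range fun n => p n x) := fun x =>
    ⟨l1 x, by rintro _ ⟨n, rfl⟩; exact (hp n).le_l1 x⟩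
  refine ⟨fun x => Real.iSup_nonneg fun n => (hp n).nonneg x,
    fun x => ciSup_le fun n => (hp n).le_l1 x, fun c x => ?_, fun x y => ?_⟩
  · simp_rw [(hp _).smul]
    rw [Real.mul_iSup_of_nonneg (abs_nonneg c)]
  · exact ciSup_le fun n => ((hp n).add_le x y).trans
      (add_le_add (le_ciSup (hb x) n) (le_ciSup (hb y) n))

theorem isGood_coord (k : ℕ+) : IsGood (fun x => |x k|) :=
  ⟨fun _ => abs_nonneg _, fun x => abs_le_l1 x k, fun c x => by simp [abs_mul],
    fun x y => abs_add_le _ _⟩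

theorem isGood_max {p q : (ℕ+ →₀ ℝ) → ℝ} (hp : IsGood p) (hq : IsGood q) :
    IsGood (fun x => max (p x) (q x)) := by
  refine ⟨fun x => le_max_of_le_left (hp.nonneg x), fun x => max_le (hp.le_l1 x) (hq.le_l1 x),
    fun c x => ?_, fun x y => ?_⟩
  · simp only [hp.smul, hq.smul]
    rw [mul_max_of_nonneg _ _ (abs_nonneg c)]
  · exact max_le ((hp.add_le x y).trans (add_le_add (le_max_left _ _) (le_max_left _ _)))
      ((hq.add_le x y).trans (add_le_add (le_max_right _ _) (le_max_right _ _)))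

theorem isGood_sum {θ : ℝ} (hθ : θ ∈ Set.Ioc (0 : ℝ) (1 / 2)) {p : (ℕ+ →₀ ℝ) → ℝ} (hp : IsGood p)
    {d : ℕ} {E : Fin d → Finset ℕ+} (hE : Consecutive E) :
    IsGood (fun x => θ * ∑ i, p (proj (E i) x)) := by
  have h0 : 0 ≤ θ := hθ.1.le
  have h1 : θ ≤ 1 := hθ.2.trans (by norm_num)
  refine ⟨fun x => mul_nonneg h0 (Finset.sum_nonneg fun i _ => hp.nonneg _), fun x => ?_,
    fun c x => ?_, fun x y => ?_⟩
  · have hs : ∑ i, p (proj (E i) x) ≤ l1 x :=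
      (Finset.sum_le_sum fun i _ => hp.le_l1 _).trans (sum_l1_proj_le hE x)
    have hn : 0 ≤ ∑ i, p (proj (E i) x) := Finset.sum_nonneg fun i _ => hp.nonneg _
    exact (mul_le_of_le_one_left hn h1).trans hs
  · simp_rw [proj_smul, hp.smul, ← Finset.mul_sum]
    ring
  · rw [← mul_add, ← Finset.sum_add_distrib]
    refine mul_le_mul_of_nonneg_left (Finset.sum_le_sum fun i _ => ?_) h0
    rw [proj_add]
    exact hp.add_le _ _

theorem isGood_zero : IsGood (fun _ => 0) :=
  ⟨fun _ => le_rfl, l1_nonneg, fun _ _ => by simp, fun _ _ => by simp⟩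

theorem isGood_sSup_values {θ : ℝ} (hθ : θ ∈ Set.Ioc (0 : ℝ) (1 / 2)) (F : Set (Finset ℕ+))
    {p : (ℕ+ →₀ ℝ) → ℝ} (hp : IsGood p) : IsGood (fun x => sSup (values θ F p x)) := by
  have key : ∀ x, values θ F p x = Set.range
      (fun e : {e : Σ d : ℕ, Fin d → Finset ℕ+ // Admissible F e.2} =>
        θ * ∑ i, p (proj (e.1.2 i) x)) := by
    intro x
    ext r
    constructor
    · rintro ⟨d, E, hE, rfl⟩
      exact ⟨⟨⟨d, E⟩, hE⟩, rfl⟩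
    · rintro ⟨⟨⟨d, E⟩, hE⟩, rfl⟩
      exact ⟨d, E, hE, rfl⟩
  simp_rw [key]
  rcases isEmpty_or_nonempty {e : Σ d : ℕ, Fin d → Finset ℕ+ // Admissible F e.2} with h | h
  · simp only [Set.range_eq_empty, Real.sSup_empty]
    exact isGood_zero
  · exact isGood_iSup fun e => isGood_sum hθ hp e.2.1

theorem isGood_normSeq {θ : ℝ} (hθ : θ ∈ Set.Ioc (0 : ℝ) (1 / 2)) (F : Set (Finset ℕ+)) (n : ℕ) :
    IsGood (normSeq θ F n) := by
  induction n with
  | zero => exact isGood_iSup isGood_coord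
  | succ n ih => exact isGood_max ih (isGood_sSup_values hθ F ih)

theorem isGood_tsirelsonNorm {θ : ℝ} (hθ : θ ∈ Set.Ioc (0 : ℝ) (1 / 2)) (F : Set (Finset ℕ+)) :
    IsGood (tsirelsonNorm θ F) :=
  isGood_iSup fun n => isGood_normSeq hθ F n

theorem abs_le_tsirelsonNorm {θ : ℝ} (hθ : θ ∈ Set.Ioc (0 : ℝ) (1 / 2)) (F : Set (Finset ℕ+))
    (x : ℕ+ →₀ ℝ) (k : ℕ+) : |x k| ≤ tsirelsonNorm θ F x := by
  have h1 : |x k| ≤ normSeq θ F 0 x :=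
    le_ciSup (f := fun k => |x k|) ⟨l1 x, by rintro _ ⟨n, rfl⟩; exact abs_le_l1 x n⟩ k
  exact h1.trans (le_ciSup (f := fun n => normSeq θ F n x)
    ⟨l1 x, by rintro _ ⟨n, rfl⟩; exact (isGood_normSeq hθ F n).le_l1 x⟩ 0)

/-- The vector space `c₀₀`, to be normed by `tsirelsonNorm θ F`. -/
def C00 (θ : ℝ) (_ : θ ∈ Set.Ioc (0 : ℝ) (1 / 2)) (_ : Set (Finset ℕ+)) : Type := ℕ+ →₀ ℝ

variable (θ : ℝ) (hθ : θ ∈ Set.Ioc (0 : ℝ) (1 / 2)) (F : Set (Finset ℕ+))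

instance : AddCommGroup (C00 θ hθ F) := inferInstanceAs (AddCommGroup (ℕ+ →₀ ℝ))

instance : Module ℝ (C00 θ hθ F) := inferInstanceAs (Module ℝ (ℕ+ →₀ ℝ))

instance : Norm (C00 θ hθ F) := ⟨tsirelsonNorm θ F⟩

theorem C00.core : NormedSpace.Core ℝ (C00 θ hθ F) where
  norm_nonneg x := (isGood_tsirelsonNorm hθ F).nonneg x
  norm_smul c x := (isGood_tsirelsonNorm hθ F).smul c x
  norm_triangle x y := (isGood_tsirelsonNorm hθ F).add_le x y
  norm_eq_zero_iff x := by
    constructor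
    · intro h
      refine Finsupp.ext fun k => ?_
      have h1 := abs_le_tsirelsonNorm hθ F x k
      have h2 : tsirelsonNorm θ F x = 0 := h
      rw [h2] at h1
      exact abs_nonpos_iff.mp h1
    · rintro rfl
      have h := (isGood_tsirelsonNorm hθ F).smul 0 0
      rw [zero_smul, abs_zero, zero_mul] at h
      exact h

instance : NormedAddCommGroup (C00 θ hθ F) := NormedAddCommGroup.ofCore (C00.core θ hθ F)

instance : NormedSpace ℝ (C00 θ hθ F) := NormedSpace.ofCore (C00.core θ hθ F)

/-- The Banach space `T[θ, F]`: the completion of `c₀₀`. -/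
abbrev Space : Type := UniformSpace.Completion (C00 θ hθ F)

/-- The unit vectors of `c₀₀`, as elements of `T[θ, F]`. -/
def unitVec (k : ℕ+) : Space θ hθ F :=
  ((show C00 θ hθ F from Finsupp.single k (1 : ℝ)) : UniformSpace.Completion (C00 θ hθ F))

end Tsirelson

end

open Tsirelson

/-!
Call `± e_k` a vertex of the sphere. A point `y` is at distance `2` from `s e_k` exactly when its
`k`-th coordinate is `-s`, and a face, the set of points with a given coordinate equal to `± 1`, has
a vertex as centre of symmetry. By the reflection argument of the Mazur–Ulam theorem, a surjective
isometry `U` of the sphere therefore maps a vertex to a vertex as soon as the image has one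
coordinate of modulus `1`.

For the images `U e_k` with `k` large, such a coordinate comes from a limit. The basis is boundedly
complete, so along an ultrafilter the `U e_k` converge coordinatewise to a vector `w`, and
`‖U e_k - w‖ = 1` with mutual distances `1`; in `T[θ, F]` this forces `U e_k - w` to have a
coordinate of modulus `1`. Comparison with sums of `θ⁻¹` unit vectors shows that `w` lives on the
first `θ⁻¹` coordinates, so the coordinate of modulus `1` belongs to `U e_k` itself. Applied to
`U⁻¹`, this puts every `U (± e_k)` within `1` of almost all `e_m`, which forces a coordinate of
modulus `1` again.

Hence `U` maps vertices to vertices, and distances to points with prescribed `i`-th coordinate show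
that it permutes the coordinates up to signs, so it extends to a linear isometry. The norm of an
indicator vector `1_A` with `|A| > θ⁻¹` equals `θ |A|` exactly when `A` is in the family, so the
permutation preserves membership of these sets in `S_α`. For `α = 1` this fixes every index above
`θ⁻¹`, and for `α > 1` it fixes all indices.
-/

open Filter Topology

noncomputable section

namespace Tsirelson

/-! ### Hereditary spreading families -/

/-- The hereditary and spreading families of finite sets, in one condition: `A` belongs to the
family if a strictly increasing map that does not increase any element sends `A` into a member. -/
def HereditarySpreading (F : Set (Finset ℕ+)) : Prop :=
  ∀ ⦃A G : Finset ℕ+⦄ (m : ℕ+ → ℕ+), G ∈ F → StrictMonoOn m A →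
    (∀ a ∈ A, m a ≤ a ∧ m a ∈ G) → A ∈ F

/-- The Schreier family `S₁`, described by cardinalities (see `schreier_one`). -/
def firstSchreier : Set (Finset ℕ+) := {G | ∀ k ∈ G, G.card ≤ (k : ℕ)}

theorem mem_firstSchreier_of_card_le_one {G : Finset ℕ+} (hG : G.card ≤ 1) : G ∈ firstSchreier :=
  fun k _ => hG.trans k.pos

namespace HereditarySpreading

variable {F : Set (Finset ℕ+)}

theorem isLowerSet (hF : HereditarySpreading F) : IsLowerSet F := fun _ _ hAG hG =>
  hF id hG (strictMono_id.strictMonoOn _) fun _ ha => ⟨le_rfl, hAG ha⟩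

theorem image_mem_of_le (hF : HereditarySpreading F) {ι : Type*} [LinearOrder ι] {s : Finset ι}
    {f g : ι → ℕ+} (hf : StrictMono f) (hg : StrictMono g) (hfg : f ≤ g) (h : s.image f ∈ F) :
    s.image g ∈ F := by
  have hm : ∀ i, Function.extend g f id (g i) = f i := hg.injective.extend_apply f id
  refine hF (Function.extend g f id) h ?_ ?_
  · rw [Finset.coe_image]
    rintro _ ⟨i, -, rfl⟩ _ ⟨j, -, rfl⟩ hij
    rw [hm, hm]
    exact hf (hg.lt_iff_lt.1 hij)
  · intro a ha
    obtain ⟨i, hi, rfl⟩ := Finset.mem_image.1 ha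
    rw [hm]
    exact ⟨hfg i, Finset.mem_image_of_mem f hi⟩

theorem insert_mem_of_le (hF : HereditarySpreading F) {A : Finset ℕ+} {i j : ℕ+} (hij : i ≤ j)
    (hA : ∀ a ∈ A, a < i ∨ j < a) (h : insert i A ∈ F) : insert j A ∈ F := by
  have hm : ∀ a ∈ A, Function.update id j i a = a := fun a ha =>
    Function.update_of_ne ((hA a ha).elim (fun h => (h.trans_le hij).ne) ne_of_gt) i id
  refine hF (Function.update id j i) h ?_ ?_
  · intro a ha b hb hab
    rw [Finset.mem_coe, Finset.mem_insert] at ha hb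
    rcases ha with rfl | ha <;> rcases hb with rfl | hb
    · exact absurd hab (lt_irrefl _)
    · rw [Function.update_self, hm b hb]
      exact hij.trans_lt hab
    · rw [Function.update_self, hm a ha]
      exact (hA a ha).resolve_right hab.not_gt
    · rwa [hm a ha, hm b hb]
  · rw [Finset.forall_mem_insert, Function.update_self]
    exact ⟨⟨hij, Finset.mem_insert_self _ _⟩, fun a ha => by simp [hm a ha, ha]⟩

end HereditarySpreading

/-! ### Unions of consecutive members of a family -/

section Consecutive

variable {d : ℕ} {E : Fin d → Finset ℕ+}

theorem Consecutive.comp (hE : Consecutive E) {e : ℕ} {f : Fin e → Fin d} (hf : StrictMono f) :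
    Consecutive (E ∘ f) :=
  ⟨fun i => hE.nonempty (f i), fun _ _ hij => hE.before _ _ (hf hij)⟩

theorem Consecutive.castSucc {E : Fin (d + 1) → Finset ℕ+} (hE : Consecutive E) :
    Consecutive fun i : Fin d => E i.castSucc :=
  hE.comp Fin.strictMono_castSucc

theorem Consecutive.snoc (hE : Consecutive E) {B : Finset ℕ+} (hB : B.Nonempty)
    (hEB : ∀ i, Before (E i) B) : Consecutive (Fin.snoc E B : Fin (d + 1) → Finset ℕ+) := by
  refine ⟨fun i => ?_, fun i j hij => ?_⟩
  · cases i using Fin.lastCases with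
    | last => simpa only [Fin.snoc_last] using hB
    | cast i => simpa only [Fin.snoc_castSucc] using hE.nonempty i
  · cases j using Fin.lastCases with
    | last =>
      obtain ⟨i, rfl⟩ := Fin.exists_castSucc_eq.2 hij.ne
      simpa only [Fin.snoc_castSucc, Fin.snoc_last] using hEB i
    | cast j =>
      obtain ⟨i, rfl⟩ := Fin.exists_castSucc_eq.2 (hij.trans (Fin.castSucc_lt_last j)).ne
      simpa only [Fin.snoc_castSucc] using hE.before i j (Fin.castSucc_lt_castSucc_iff.1 hij)

theorem Consecutive.strictMono_min' (hE : Consecutive E) :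
    StrictMono fun i => (E i).min' (hE.nonempty i) :=
  fun i j hij => hE.before i j hij _ (Finset.min'_mem _ _) _ (Finset.min'_mem _ _)

end Consecutive

theorem biUnion_fin_succ {d : ℕ} (B : Fin (d + 1) → Finset ℕ+) :
    Finset.univ.biUnion B =
      (Finset.univ.biUnion fun i : Fin d => B i.castSucc) ∪ B (Fin.last d) := by
  ext k
  simp only [Finset.mem_biUnion, Finset.mem_union, Finset.mem_univ, true_and]
  exact Fin.exists_fin_succ' (P := fun i => k ∈ B i)

/-- `G` is the union of `d` possibly empty members `B₁ < ⋯ < B_d` of `S`. Empty pieces are allowed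
so that the property passes to subsets without renumbering. -/
def IsChainUnion (S : Set (Finset ℕ+)) : ℕ → Finset ℕ+ → Prop
  | 0, G => G = ∅
  | d + 1, G => ∃ A B, IsChainUnion S d A ∧ B ∈ S ∧ Before A B ∧ G = A ∪ B

namespace IsChainUnion

variable {S : Set (Finset ℕ+)} {d e : ℕ} {A B G : Finset ℕ+}

theorem union (hA : IsChainUnion S d A) (hB : B ∈ S) (hAB : Before A B) :
    IsChainUnion S (d + 1) (A ∪ B) :=
  ⟨A, B, hA, hB, hAB, rfl⟩

theorem mono_family {T : Set (Finset ℕ+)} (hST : S ⊆ T) (hG : IsChainUnion S d G) :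
    IsChainUnion T d G := by
  induction d generalizing G with
  | zero => exact hG
  | succ d ih =>
    obtain ⟨A, B, hA, hB, hAB, rfl⟩ := hG
    exact (ih hA).union (hST hB) hAB

theorem mono_length (hS : ∅ ∈ S) (hde : d ≤ e) (hG : IsChainUnion S d G) : IsChainUnion S e G := by
  induction e, hde using Nat.le_induction with
  | base => exact hG
  | succ e _ ih => simpa using ih.union hS (by simp [Before])

theorem hereditarySpreading (hS : HereditarySpreading S) (d : ℕ) :
    HereditarySpreading {G | IsChainUnion S d G} := by
  induction d with
  | zero =>
    rintro A G m (rfl : G = ∅) - h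
    exact Finset.eq_empty_of_forall_notMem fun a ha => Finset.notMem_empty _ (h a ha).2
  | succ d ih =>
    rintro D _ m ⟨A, B, hA, hB, hAB, rfl⟩ hm h
    refine ⟨{a ∈ D | m a ∈ A}, {a ∈ D | m a ∈ B}, ih m hA (hm.mono ?_) ?_, hS m hB (hm.mono ?_) ?_,
      ?_, ?_⟩
    · exact Finset.coe_subset.2 (Finset.filter_subset _ _)
    · exact fun a ha => ⟨(h a (Finset.mem_filter.1 ha).1).1, (Finset.mem_filter.1 ha).2⟩
    · exact Finset.coe_subset.2 (Finset.filter_subset _ _)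
    · exact fun a ha => ⟨(h a (Finset.mem_filter.1 ha).1).1, (Finset.mem_filter.1 ha).2⟩
    · intro a ha b hb
      rw [Finset.mem_filter] at ha hb
      exact (hm.lt_iff_lt ha.1 hb.1).1 (hAB _ ha.2 _ hb.2)
    · rw [← Finset.filter_or, Finset.filter_true_of_mem]
      exact fun a ha => Finset.mem_union.1 (h a ha).2

theorem of_consecutive {B : Fin d → Finset ℕ+} (hB : Consecutive B) (hBS : ∀ i, B i ∈ S) :
    IsChainUnion S d (Finset.univ.biUnion B) := by
  induction d with
  | zero => rfl
  | succ d ih =>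
    rw [biUnion_fin_succ]
    refine (ih hB.castSucc fun i => hBS _).union (hBS _) fun a ha b hb => ?_
    obtain ⟨i, -, hi⟩ := Finset.mem_biUnion.1 ha
    exact hB.before _ _ (Fin.castSucc_lt_last i) a hi b hb

theorem exists_consecutive (hG : IsChainUnion S d G) :
    ∃ (e : ℕ) (B : Fin e → Finset ℕ+), e ≤ d ∧ Consecutive B ∧ (∀ i, B i ∈ S) ∧
      G = Finset.univ.biUnion B := by
  induction d generalizing G with
  | zero => exact ⟨0, Fin.elim0, le_rfl, ⟨Fin.rec0, Fin.rec0⟩, Fin.rec0, hG⟩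
  | succ d ih =>
    obtain ⟨A, C, hA, hC, hAC, rfl⟩ := hG
    obtain ⟨e, B, hed, hB, hBS, rfl⟩ := ih hA
    rcases C.eq_empty_or_nonempty with rfl | hne
    · exact ⟨e, B, hed.trans d.le_succ, hB, hBS, Finset.union_empty _⟩
    · refine ⟨e + 1, Fin.snoc B C, Nat.succ_le_succ hed, hB.snoc hne fun i a ha =>
        hAC a (Finset.mem_biUnion.2 ⟨i, Finset.mem_univ i, ha⟩), fun i => ?_, ?_⟩
      · cases i using Fin.lastCases with
        | last => simpa only [Fin.snoc_last] using hC
        | cast i => simpa only [Fin.snoc_castSucc] using hBS i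
      · simp only [biUnion_fin_succ, Fin.snoc_castSucc, Fin.snoc_last]

theorem one_iff : IsChainUnion S 1 G ↔ G ∈ S := by
  constructor
  · rintro ⟨A, B, rfl, hB, -, rfl⟩
    rwa [Finset.empty_union]
  · exact fun hG => ⟨∅, G, rfl, hG, by simp [Before], by simp⟩

theorem card_le_one_iff : IsChainUnion {G | G.card ≤ 1} d G ↔ G.card ≤ d := by
  constructor
  · intro hG
    induction d generalizing G with
    | zero => exact (Finset.card_eq_zero.2 hG).le
    | succ d ih =>
      obtain ⟨A, B, hA, hB, -, rfl⟩ := hG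
      exact (Finset.card_union_le A B).trans (add_le_add (ih hA) hB)
  · intro hG
    induction d generalizing G with
    | zero => exact Finset.card_eq_zero.1 (Nat.le_zero.1 hG)
    | succ d ih =>
      rcases G.eq_empty_or_nonempty with rfl | hne
      · exact mono_length (d := 0) (by simp) (Nat.zero_le _) rfl
      · have hcard : (G.erase (G.max' hne)).card ≤ d := by
          rw [Finset.card_erase_of_mem (G.max'_mem hne)]
          omega
        refine ⟨G.erase (G.max' hne), {G.max' hne}, ih hcard, (Finset.card_singleton _).le,
          fun a ha b hb => ?_, ?_⟩
        · rw [Finset.mem_singleton.1 hb]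
          exact G.lt_max'_of_mem_erase_max' hne ha
        · rw [Finset.union_comm, ← Finset.insert_eq, Finset.insert_erase (G.max'_mem hne)]

theorem not_Ico (hS : IsLowerSet S) (hSd : IsLowerSet {G | IsChainUnion S d G})
    {L t u : ℕ+} (hLt : L ≤ t) (h1 : ¬IsChainUnion S d (Finset.Ico L t))
    (h2 : Finset.Ico t u ∉ S) : ¬IsChainUnion S (d + 1) (Finset.Ico L u) := by
  rintro ⟨A, B, hA, hB, hAB, hG⟩
  have hmem : ∀ k, L ≤ k → k < u → k ∈ A ∨ k ∈ B := fun k hLk hku => by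
    rw [← Finset.mem_union, ← hG, Finset.mem_Ico]
    exact ⟨hLk, hku⟩
  obtain ⟨k, hk, hkB⟩ : ∃ k ∈ Finset.Ico t u, k ∉ B :=
    Finset.not_subset.1 fun hsub => h2 (hS hsub hB)
  rw [Finset.mem_Ico] at hk
  have hkA : k ∈ A := (hmem k (hLt.trans hk.1) hk.2).resolve_right hkB
  refine h1 (hSd (fun c hc => ?_) hA)
  rw [Finset.mem_Ico] at hc
  have hck : c < k := hc.2.trans_le hk.1
  exact (hmem c hc.1 (hck.trans hk.2)).resolve_right fun hcB => (hAB k hkA c hcB).not_gt hck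

end IsChainUnion

/-! ### Schreier families -/

section Schreier

variable {β : Ordinal.{0} → ℕ+ → Ordinal.{0}} {α : Ordinal.{0}}

theorem empty_mem_schreier (β : Ordinal.{0} → ℕ+ → Ordinal.{0}) (α : Ordinal.{0}) :
    ∅ ∈ schreier β α := by
  induction α using Ordinal.limitRecOn with
  | zero => simp [schreier_zero]
  | add_one α _ => simp [schreier_add_one]
  | limit l hl _ => simp [schreier_limit _ _ hl]

theorem mem_schreier_add_one {G : Finset ℕ+} : G ∈ schreier β (α + 1) ↔
    ∃ d, IsChainUnion (schreier β α) d G ∧ ∀ k ∈ G, d ≤ (k : ℕ) := by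
  rw [schreier_add_one]
  constructor
  · rintro (⟨d, B, hB, hBS, hd, rfl⟩ | rfl)
    · exact ⟨d, IsChainUnion.of_consecutive hB hBS, hd⟩
    · exact ⟨0, rfl, by simp⟩
  · rintro ⟨d, hG, hd⟩
    obtain ⟨e, B, hed, hB, hBS, hGB⟩ := hG.exists_consecutive
    exact Or.inl ⟨e, B, hB, hBS, fun k hk => hed.trans (hd k hk), hGB⟩

theorem mem_schreier_limit (hα : Order.IsSuccLimit α) (hβ : ∀ n, β α n + 1 < α) {G : Finset ℕ+} :
    G ∈ schreier β α ↔ ∃ n : ℕ+, G ∈ schreier β (β α n + 1) ∧ ∀ k ∈ G, n ≤ k := by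
  rw [schreier_limit _ _ hα]
  constructor
  · rintro (⟨n, -, h⟩ | rfl)
    · exact ⟨n, h⟩
    · exact ⟨1, empty_mem_schreier _ _, by simp⟩
  · rintro ⟨n, h⟩
    exact Or.inl ⟨n, hβ n, h⟩

theorem schreier_one (β : Ordinal.{0} → ℕ+ → Ordinal.{0}) : schreier β 1 = firstSchreier := by
  ext G
  rw [← zero_add 1, mem_schreier_add_one, schreier_zero]
  simp only [IsChainUnion.card_le_one_iff]
  exact ⟨fun ⟨d, hd, hG⟩ k hk => hd.trans (hG k hk), fun hG => ⟨G.card, le_rfl, hG⟩⟩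

theorem hereditarySpreading_schreier (hβ : IsLadder β) (hα : α < ω₁) :
    HereditarySpreading (schreier β α) := by
  induction α using Ordinal.limitRecOn with
  | zero =>
    intro A G m hG hm h
    rw [schreier_zero] at hG ⊢
    exact (Finset.card_le_card_of_injOn m (fun a ha => (h a ha).2) hm.injOn).trans hG
  | add_one α ih =>
    intro A G m hG hm h
    obtain ⟨d, hd, hdG⟩ := mem_schreier_add_one.1 hG
    exact mem_schreier_add_one.2 ⟨d,
      IsChainUnion.hereditarySpreading (ih ((lt_add_one _).trans hα)) d m hd hm h,
      fun a ha => (hdG _ (h a ha).2).trans (h a ha).1⟩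
  | limit l hl ih =>
    intro A G m hG hm h
    have hlt := hβ.lt l hα hl
    obtain ⟨n, hn, hnG⟩ := (mem_schreier_limit hl hlt).1 hG
    exact (mem_schreier_limit hl hlt).2 ⟨n, ih _ (hlt n) ((hlt n).trans hα) m hn hm h,
      fun a ha => (hnG _ (h a ha).2).trans (h a ha).1⟩

theorem schreier_subset_add_one (β : Ordinal.{0} → ℕ+ → Ordinal.{0}) (α : Ordinal.{0}) :
    schreier β α ⊆ schreier β (α + 1) := fun _ hG =>
  mem_schreier_add_one.2 ⟨1, IsChainUnion.one_iff.2 hG, fun k _ => k.pos⟩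

theorem firstSchreier_subset (hβ : IsLadder β) (h1 : 1 ≤ α) (hα : α < ω₁) :
    firstSchreier ⊆ schreier β α := by
  induction α using Ordinal.limitRecOn with
  | zero => simp at h1
  | add_one α ih =>
    rcases eq_or_ne α 0 with rfl | h0
    · rw [zero_add, schreier_one]
    · exact (ih (Order.one_le_iff_ne_zero.2 h0) ((lt_add_one _).trans hα)).trans
        (schreier_subset_add_one β α)
  | limit l hl ih =>
    have hlt := hβ.lt l hα hl
    exact fun G hG => (mem_schreier_limit hl hlt).2
      ⟨1, ih _ (hlt 1) (by simp) ((hlt 1).trans hα) hG, fun _ _ => one_le⟩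

theorem IsChainUnion.exists_not_Ico {S : Set (Finset ℕ+)} (hS : HereditarySpreading S)
    (h : ∀ L, ∃ t, L < t ∧ Finset.Ico L t ∉ S) (L : ℕ+) (d : ℕ) :
    ∃ t, L < t ∧ ¬IsChainUnion S d (Finset.Ico L t) := by
  induction d with
  | zero =>
    obtain ⟨t, ht, -⟩ := h L
    exact ⟨t, ht, (Finset.nonempty_Ico.2 ht).ne_empty⟩
  | succ d ih =>
    obtain ⟨t, hLt, ht⟩ := ih
    obtain ⟨u, htu, hu⟩ := h t
    exact ⟨u, hLt.trans htu, IsChainUnion.not_Ico hS.isLowerSet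
      (IsChainUnion.hereditarySpreading hS d).isLowerSet hLt.le ht hu⟩

theorem exists_Ico_notMem_schreier (hβ : IsLadder β) (hα : α < ω₁) (L : ℕ+) :
    ∃ t, L < t ∧ Finset.Ico L t ∉ schreier β α := by
  induction α using Ordinal.limitRecOn generalizing L with
  | zero =>
    refine ⟨L + 2, PNat.lt_add_right L 2, ?_⟩
    simp [schreier_zero, PNat.card_Ico]
  | add_one α ih =>
    have hα' : α < ω₁ := (lt_add_one _).trans hα
    obtain ⟨t, hLt, ht⟩ :=
      IsChainUnion.exists_not_Ico (hereditarySpreading_schreier hβ hα') (ih hα') L L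
    refine ⟨t, hLt, fun hmem => ht ?_⟩
    obtain ⟨d, hd, hdL⟩ := mem_schreier_add_one.1 hmem
    exact hd.mono_length (empty_mem_schreier β α) (hdL L (Finset.left_mem_Ico.2 hLt))
  | limit l hl ih =>
    have hlt := hβ.lt l hα hl
    choose g hLg hg using fun n => ih _ (hlt n) ((hlt n).trans hα) L
    have hle : ∀ n ≤ L, g n ≤ (Finset.Icc 1 L).sup' ⟨1, by simp⟩ g := fun n hn =>
      Finset.le_sup' g (Finset.mem_Icc.2 ⟨one_le, hn⟩)
    have hL := (hLg 1).trans_le (hle 1 one_le)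
    refine ⟨_, hL, fun hmem => ?_⟩
    obtain ⟨n, hn, hnL⟩ := (mem_schreier_limit hl hlt).1 hmem
    exact hg n ((hereditarySpreading_schreier hβ ((hlt n).trans hα)).isLowerSet
      (Finset.Ico_subset_Ico_right (hle n (hnL L (Finset.left_mem_Ico.2 hL)))) hn)

theorem card_le_one_of_one_mem_of_mem_schreier (hβ : IsLadder β) (hα : α < ω₁) {G : Finset ℕ+}
    (hG : G ∈ schreier β α) (h1 : 1 ∈ G) : G.card ≤ 1 := by
  induction α using Ordinal.limitRecOn with
  | zero => rwa [schreier_zero] at hG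
  | add_one α ih =>
    obtain ⟨d, hd, hdG⟩ := mem_schreier_add_one.1 hG
    exact ih ((lt_add_one _).trans hα)
      (IsChainUnion.one_iff.1 (hd.mono_length (empty_mem_schreier β α) (hdG 1 h1)))
  | limit l hl ih =>
    have hlt := hβ.lt l hα hl
    obtain ⟨n, hn, -⟩ := (mem_schreier_limit hl hlt).1 hG
    exact ih _ (hlt n) ((hlt n).trans hα) hn

/-- Near `i`, the family `schreier β α` consists of unions of members of one lower family. At a
limit ordinal that family depends on `i`. -/
theorem exists_isChainUnion_schreier (hβ : IsLadder β) (h1 : 1 < α) (hα : α < ω₁) {i : ℕ+}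
    (hi : 1 < i) : ∃ γ : Ordinal.{0}, 1 ≤ γ ∧ γ < ω₁ ∧
      (∀ G ∈ schreier β α, i ∈ G → IsChainUnion (schreier β γ) i G) ∧
      ∀ (G : Finset ℕ+) (d : ℕ), IsChainUnion (schreier β γ) d G →
        (∀ k ∈ G, i ≤ k ∧ d ≤ (k : ℕ)) → G ∈ schreier β α := by
  rcases Ordinal.zero_or_succ_or_isSuccLimit α with rfl | ⟨γ, rfl⟩ | hl
  · simp at h1
  · refine ⟨γ, Order.lt_add_one_iff.1 h1, (lt_add_one _).trans hα, fun G hG hiG => ?_,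
      fun G d hG hd => mem_schreier_add_one.2 ⟨d, hG, fun k hk => (hd k hk).2⟩⟩
    obtain ⟨d, hd, hdG⟩ := mem_schreier_add_one.1 hG
    exact hd.mono_length (empty_mem_schreier β γ) (hdG i hiG)
  · have hlt := hβ.lt α hα hl
    have hmono : Monotone fun n => schreier β (β α n) :=
      monotone_of_le_add_one fun n _ => hβ.subset α hα hl n
    refine ⟨β α i, ?_, (lt_add_one _).trans ((hlt i).trans hα), fun G hG hiG => ?_,
      fun G d hG hd => (mem_schreier_limit hl hlt).2 ⟨i, mem_schreier_add_one.2
        ⟨d, hG, fun k hk => (hd k hk).2⟩, fun k hk => (hd k hk).1⟩⟩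
    · exact Order.one_le_iff_pos.2 (zero_le.trans_lt (hβ.strictMono α hα hl hi))
    · obtain ⟨n, hn, hnG⟩ := (mem_schreier_limit hl hlt).1 hG
      obtain ⟨d, hd, hdG⟩ := mem_schreier_add_one.1 hn
      exact (hd.mono_length (empty_mem_schreier β _) (hdG i hiG)).mono_family (hmono (hnG i hiG))

theorem insert_Ico_mem_schreier (hβ : IsLadder β) (h1 : 1 < α) (hα : α < ω₁) {i L n : ℕ+}
    (hi : 1 < i) (hiL : i < L) (hn : n ≤ L) :
    insert i (Finset.Ico L (L + n)) ∈ schreier β α := by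
  obtain ⟨γ, hγ1, hγ, -, hchain⟩ := exists_isChainUnion_schreier hβ h1 hα hi
  have hS := firstSchreier_subset hβ hγ1 hγ
  have hIco : Finset.Ico L (L + n) ∈ firstSchreier := fun k hk => by
    rw [PNat.card_Ico, PNat.add_coe, Nat.add_sub_cancel_left]
    exact hn.trans (Finset.mem_Ico.1 hk).1
  have h2 : IsChainUnion (schreier β γ) 2 ({i} ∪ Finset.Ico L (L + n)) :=
    (IsChainUnion.one_iff.2 (hS (mem_firstSchreier_of_card_le_one (by simp)))).union (hS hIco)
      (by simpa [Before] using fun b hb _ => hiL.trans_le hb)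
  rw [← Finset.insert_eq] at h2
  refine hchain _ 2 h2 ?_
  rw [Finset.forall_mem_insert]
  exact ⟨⟨le_rfl, hi⟩, fun k hk =>
    have hik : i < k := hiL.trans_le (Finset.mem_Ico.1 hk).1
    ⟨hik.le, hi.trans hik⟩⟩

/-- Moving `i` to `i + 1` leaves room for one more piece, which is used for the new element `t`. -/
theorem insert_add_one_Ico_mem_schreier (hβ : IsLadder β) (h1 : 1 < α) (hα : α < ω₁)
    {i L t : ℕ+} (hi : 1 < i) (hiL : i + 1 < L) (hLt : L ≤ t)
    (h : insert i (Finset.Ico L t) ∈ schreier β α) :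
    insert (i + 1) (Finset.Ico L (t + 1)) ∈ schreier β α := by
  obtain ⟨γ, hγ1, hγ, hdown, hchain⟩ := exists_isChainUnion_schreier hβ h1 hα hi
  have hspread := IsChainUnion.hereditarySpreading (hereditarySpreading_schreier hβ hγ) i
  have hlt : ∀ k ∈ Finset.Ico L t, i + 1 < k := fun k hk => hiL.trans_le (Finset.mem_Ico.1 hk).1
  have hi' : IsChainUnion (schreier β γ) i (insert (i + 1) (Finset.Ico L t)) :=
    hspread.insert_mem_of_le (PNat.lt_add_right i 1).le (fun a ha => Or.inr (hlt a ha))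
      (hdown _ h (Finset.mem_insert_self _ _))
  have ht : {t} ∈ schreier β γ :=
    firstSchreier_subset hβ hγ1 hγ (mem_firstSchreier_of_card_le_one (by simp))
  have hsplit : insert (i + 1) (Finset.Ico L (t + 1)) = insert (i + 1) (Finset.Ico L t) ∪ {t} := by
    ext k
    simp only [Finset.mem_insert, Finset.mem_union, Finset.mem_Ico, Finset.mem_singleton,
      PNat.lt_add_one_iff]
    grind
  rw [hsplit]
  refine hchain _ (i + 1) (hi'.union ht ?_) fun k hk => ?_
  · simp only [Before, Finset.mem_insert, Finset.mem_Ico, Finset.mem_singleton]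
    grind
  · have hik : i + 1 ≤ k := by
      simp only [Finset.mem_union, Finset.mem_insert, Finset.mem_Ico, Finset.mem_singleton] at hk
      grind
    exact ⟨(PNat.lt_add_right i 1).le.trans hik, hik⟩

theorem exists_insert_Ico_notMem_schreier (hβ : IsLadder β) (h1 : 1 < α) (hα : α < ω₁) {i L n : ℕ+}
    (hiL : i + 1 < L) (hn : n ≤ L) : ∃ t, L + n ≤ t ∧
      insert (i + 1) (Finset.Ico L t) ∈ schreier β α ∧
        insert i (Finset.Ico L t) ∉ schreier β α := by
  have hbase : insert (i + 1) (Finset.Ico L (L + n)) ∈ schreier β α :=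
    insert_Ico_mem_schreier hβ h1 hα (PNat.lt_add_left 1 i) hiL hn
  by_contra! hcon
  have hi : 1 < i := by
    by_contra! hi
    have hmem := hcon _ le_rfl hbase
    rw [le_one_iff_eq_one.1 hi] at hmem
    have hcard := card_le_one_of_one_mem_of_mem_schreier hβ hα hmem (Finset.mem_insert_self _ _)
    rw [Finset.card_insert_of_notMem, PNat.card_Ico, PNat.add_coe] at hcard
    · have := n.pos
      omega
    · exact fun h => (one_le.trans_lt hiL).not_ge (Finset.mem_Ico.1 h).1
  have hall : ∀ ⦃t⦄, L + n ≤ t → insert (i + 1) (Finset.Ico L t) ∈ schreier β α := by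
    refine @Succ.rec _ _ _ _ _ (fun t _ => insert (i + 1) (Finset.Ico L t) ∈ schreier β α) hbase
      fun t hLt ht => ?_
    exact insert_add_one_Ico_mem_schreier hβ h1 hα hi hiL
      ((PNat.lt_add_right L n).le.trans hLt) (hcon t hLt ht)
  obtain ⟨t, -, ht⟩ := exists_Ico_notMem_schreier hβ hα L
  refine ht ((hereditarySpreading_schreier hβ hα).isLowerSet ?_ (hall (le_max_right t (L + n))))
  exact (Finset.Ico_subset_Ico_right (le_max_left _ _)).trans (Finset.subset_insert _ _)

theorem exists_separating_schreier (hβ : IsLadder β) (h1 : 1 < α) (hα : α < ω₁) (n : ℕ+)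
    {i j : ℕ+} (hij : i < j) : ∃ A : Finset ℕ+, (∀ a ∈ A, j < a) ∧ (n : ℕ) ≤ A.card ∧
      insert j A ∈ schreier β α ∧ insert i A ∉ schreier β α := by
  have hij' : i + 1 ≤ j := PNat.add_one_le_iff.2 hij
  have hjL : j < j + n := PNat.lt_add_right j n
  obtain ⟨t, ht, hmem, hnot⟩ := exists_insert_Ico_notMem_schreier hβ h1 hα (hij'.trans_lt hjL)
    (PNat.lt_add_left n j).le
  have hlt : ∀ a ∈ Finset.Ico (j + n) t, j < a := fun a ha =>
    hjL.trans_le (Finset.mem_Ico.1 ha).1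
  refine ⟨Finset.Ico (j + n) t, hlt, ?_, ?_, hnot⟩
  · rw [PNat.card_Ico]
    exact le_tsub_of_add_le_left ht
  · exact (hereditarySpreading_schreier hβ hα).insert_mem_of_le hij'
      (fun a ha => Or.inr (hlt a ha)) hmem

end Schreier

/-! ### Permutations preserving a Schreier family -/

/-- `π` maps the members of `F` with more than `n` elements to members, and the other sets with
more than `n` elements to other sets. -/
def PreservesLarge (F : Set (Finset ℕ+)) (n : ℕ) (π : Equiv.Perm ℕ+) : Prop :=
  ∀ A : Finset ℕ+, n < A.card → (A.image π ∈ F ↔ A ∈ F)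

namespace PreservesLarge

variable {F : Set (Finset ℕ+)} {n : ℕ+} {π : Equiv.Perm ℕ+}

theorem symm (hπ : PreservesLarge F n π) : PreservesLarge F n π.symm := fun A hA => by
  rw [← hπ _ (by rwa [Finset.card_image_of_injective _ π.symm.injective]), Finset.image_image,
    Equiv.self_comp_symm, Finset.image_id]

theorem insert_mem_iff (hπ : PreservesLarge F n π) {A : Finset ℕ+} {k : ℕ+} (hk : k ∉ A)
    (hA : (n : ℕ) ≤ A.card) : insert (π k) (A.image π) ∈ F ↔ insert k A ∈ F := by
  rw [← hπ (insert k A), Finset.image_insert]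
  rw [Finset.card_insert_of_notMem hk]
  exact Nat.lt_succ_of_le hA

theorem le_apply_of_lt (hπ : PreservesLarge firstSchreier n π) {i : ℕ+} (hi : n < i) :
    i ≤ π i := by
  have hcard : (Finset.Ico i (i + i)).card = i := by simp [PNat.card_Ico]
  have hmem : Finset.Ico i (i + i) ∈ firstSchreier := fun k hk =>
    hcard.trans_le (Finset.mem_Ico.1 hk).1
  have himage := (hπ _ (by rwa [hcard])).2 hmem (π i)
    (Finset.mem_image_of_mem π (Finset.left_mem_Ico.2 (PNat.lt_add_right i i)))
  rwa [Finset.card_image_of_injective _ π.injective, hcard] at himage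

theorem apply_eq_of_lt (hπ : PreservesLarge firstSchreier n π) {i : ℕ+} (hi : n < i) :
    π i = i := by
  have hle := hπ.le_apply_of_lt hi
  refine hle.antisymm' ?_
  simpa using hπ.symm.le_apply_of_lt (hi.trans_le hle)

theorem strictMono_of_schreier {β : Ordinal.{0} → ℕ+ → Ordinal.{0}} {α : Ordinal.{0}}
    (hβ : IsLadder β) (h1 : 1 < α) (hα : α < ω₁) (hπ : PreservesLarge (schreier β α) n π) :
    StrictMono π := by
  refine strictMono_of_lt_add_one fun i _ => ?_
  by_contra! hle
  have hlt : π (i + 1) < π i := hle.lt_of_ne (π.injective.ne (PNat.lt_add_right i 1).ne')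
  obtain ⟨A, hA, hcard, hmem, hnot⟩ := exists_separating_schreier hβ h1 hα n hlt
  obtain ⟨B, rfl⟩ : ∃ B : Finset ℕ+, B.image π = A := ⟨A.image π.symm, by simp [Finset.image_image]⟩
  rw [Finset.card_image_of_injective _ π.injective] at hcard
  have hi : i ∉ B := fun h => (hA _ (Finset.mem_image_of_mem π h)).false
  have hi1 : i + 1 ∉ B := fun h => (hlt.trans (hA _ (Finset.mem_image_of_mem π h))).false
  refine hnot ((hπ.insert_mem_iff hi1 hcard).2 ?_)
  refine (hereditarySpreading_schreier hβ hα).insert_mem_of_le (PNat.lt_add_right i 1).le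
    (fun b hb => ?_) ((hπ.insert_mem_iff hi hcard).1 hmem)
  refine (ne_of_mem_of_not_mem hb hi).lt_or_gt.imp_right fun hib => ?_
  exact (PNat.add_one_le_iff.2 hib).lt_of_ne (ne_of_mem_of_not_mem hb hi1).symm

theorem eq_refl_of_schreier {β : Ordinal.{0} → ℕ+ → Ordinal.{0}} {α : Ordinal.{0}}
    (hβ : IsLadder β) (h1 : 1 < α) (hα : α < ω₁) (hπ : PreservesLarge (schreier β α) n π) :
    π = Equiv.refl ℕ+ := by
  ext1 i
  refine (hπ.strictMono_of_schreier hβ h1 hα).le_apply.antisymm' ?_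
  simpa using (hπ.symm.strictMono_of_schreier hβ h1 hα).le_apply (x := π i)

end PreservesLarge

/-! ### The norm on finitely supported vectors -/

section FinitelySupported

variable {θ : ℝ} (hθ : θ ∈ Set.Ioc (0 : ℝ) (1 / 2)) {F : Set (Finset ℕ+)}

theorem abs_proj_le (E : Finset ℕ+) (x : ℕ+ →₀ ℝ) (k : ℕ+) : |proj E x k| ≤ |x k| := by
  rw [proj, Finsupp.filter_apply]
  split_ifs <;> simp

include hθ

theorem bddAbove_values (F : Set (Finset ℕ+)) (n : ℕ) (x : ℕ+ →₀ ℝ) :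
    BddAbove (values θ F (normSeq θ F n) x) := by
  refine ⟨l1 x, ?_⟩
  rintro _ ⟨d, E, hE, rfl⟩
  exact (isGood_sum hθ (isGood_normSeq hθ F n) hE.1).le_l1 x

theorem bddAbove_normSeq (F : Set (Finset ℕ+)) (x : ℕ+ →₀ ℝ) :
    BddAbove (Set.range fun n => normSeq θ F n x) :=
  ⟨l1 x, by rintro _ ⟨n, rfl⟩; exact (isGood_normSeq hθ F n).le_l1 x⟩

theorem normSeq_le_tsirelsonNorm (F : Set (Finset ℕ+)) (n : ℕ) (x : ℕ+ →₀ ℝ) :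
    normSeq θ F n x ≤ tsirelsonNorm θ F x :=
  le_ciSup (bddAbove_normSeq hθ F x) n

theorem sum_proj_le_tsirelsonNorm {d : ℕ} {E : Fin d → Finset ℕ+} (hE : Admissible F E)
    (x : ℕ+ →₀ ℝ) : θ * ∑ i, tsirelsonNorm θ F (proj (E i) x) ≤ tsirelsonNorm θ F x := by
  have hmono : ∀ y, Monotone fun n => normSeq θ F n y := fun y =>
    monotone_nat_of_le_succ fun _ => le_max_left _ _
  have hlim : Tendsto (fun n => θ * ∑ i, normSeq θ F n (proj (E i) x)) atTop
      (𝓝 (θ * ∑ i, tsirelsonNorm θ F (proj (E i) x))) :=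
    (tendsto_finsetSum _ fun i _ => tendsto_atTop_ciSup (hmono _)
      (bddAbove_normSeq hθ F _)).const_mul θ
  refine le_of_tendsto' hlim fun n => le_trans ?_ (normSeq_le_tsirelsonNorm hθ F (n + 1) x)
  exact (le_csSup (bddAbove_values hθ F n x) ⟨d, E, hE, rfl⟩).trans (le_max_right _ _)

theorem tsirelsonNorm_le {x : ℕ+ →₀ ℝ} {b : ℝ} (hcoord : ∀ k, |x k| ≤ b)
    (hsum : ∀ (d : ℕ) (E : Fin d → Finset ℕ+), Admissible F E →
      θ * ∑ i, tsirelsonNorm θ F (proj (E i) x) ≤ b) : tsirelsonNorm θ F x ≤ b := by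
  have hb : 0 ≤ b := (abs_nonneg _).trans (hcoord 1)
  refine ciSup_le fun n => ?_
  induction n with
  | zero => exact ciSup_le hcoord
  | succ n ih =>
    refine max_le ih (Real.sSup_le ?_ hb)
    rintro _ ⟨d, E, hE, rfl⟩
    refine le_trans (mul_le_mul_of_nonneg_left ?_ hθ.1.le) (hsum d E hE)
    exact Finset.sum_le_sum fun i _ => normSeq_le_tsirelsonNorm hθ F n _

theorem normSeq_le_of_abs_le (F : Set (Finset ℕ+)) (n : ℕ) {x y : ℕ+ →₀ ℝ}
    (h : ∀ k, |x k| ≤ |y k|) : normSeq θ F n x ≤ normSeq θ F n y := by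
  induction n generalizing x y with
  | zero =>
    exact ciSup_le fun k => (h k).trans (le_ciSup (f := fun k => |y k|)
      ⟨l1 y, by rintro _ ⟨n, rfl⟩; exact abs_le_l1 y n⟩ k)
  | succ n ih =>
    refine max_le ((ih h).trans (le_max_left _ _)) (Real.sSup_le ?_ ?_)
    · rintro _ ⟨d, E, hE, rfl⟩
      refine le_trans (mul_le_mul_of_nonneg_left ?_ hθ.1.le)
        ((le_csSup (bddAbove_values hθ F n y) ⟨d, E, hE, rfl⟩).trans (le_max_right _ _))
      refine Finset.sum_le_sum fun i _ => ih fun k => ?_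
      simp only [proj, Finsupp.filter_apply]
      split_ifs
      · exact h k
      · exact le_rfl
    · exact (isGood_normSeq hθ F (n + 1)).nonneg y

theorem tsirelsonNorm_le_of_abs_le (F : Set (Finset ℕ+)) {x y : ℕ+ →₀ ℝ}
    (h : ∀ k, |x k| ≤ |y k|) : tsirelsonNorm θ F x ≤ tsirelsonNorm θ F y :=
  ciSup_le fun n => (normSeq_le_of_abs_le hθ F n h).trans (normSeq_le_tsirelsonNorm hθ F n y)

end FinitelySupported

/-! ### Coordinates and coordinate projections -/

section Space

variable (θ : ℝ) (hθ : θ ∈ Set.Ioc (0 : ℝ) (1 / 2)) (F : Set (Finset ℕ+))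

/-- The inclusion of `c₀₀` into `T[θ, F]`. -/
def embed : (ℕ+ →₀ ℝ) →ₗ[ℝ] Space θ hθ F where
  toFun x := ((show C00 θ hθ F from x) : UniformSpace.Completion (C00 θ hθ F))
  map_add' x y := UniformSpace.Completion.coe_add (α := C00 θ hθ F) x y
  map_smul' c x := UniformSpace.Completion.coe_smul (X := C00 θ hθ F) c x

/-- The coordinate functionals on `c₀₀`. -/
def coordC00 (k : ℕ+) : C00 θ hθ F →L[ℝ] ℝ :=
  LinearMap.mkContinuous (Finsupp.lapply k : (ℕ+ →₀ ℝ) →ₗ[ℝ] ℝ) 1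
    fun x => by rw [one_mul]; exact abs_le_tsirelsonNorm hθ F x k

variable {θ hθ F}

/-- The coordinate functionals on `T[θ, F]`. -/
def coord (k : ℕ+) : Space θ hθ F →L[ℝ] ℝ :=
  (coordC00 θ hθ F k).extend UniformSpace.Completion.toComplL

/-- The projection of `T[θ, F]` onto the coordinates in `E`. -/
def restr (E : Finset ℕ+) : Space θ hθ F →L[ℝ] Space θ hθ F :=
  ∑ k ∈ E, (coord k).smulRight (unitVec θ hθ F k)

theorem restr_apply (E : Finset ℕ+) (x : Space θ hθ F) :
    restr E x = ∑ k ∈ E, coord k x • unitVec θ hθ F k := by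
  simp only [restr, sum_apply, ContinuousLinearMap.smulRight_apply]

theorem embed_induction {p : Space θ hθ F → Prop} (hp : IsClosed {x | p x})
    (h : ∀ x, p (embed θ hθ F x)) (x : Space θ hθ F) : p x :=
  UniformSpace.Completion.induction_on x hp h

theorem norm_embed (x : ℕ+ →₀ ℝ) : ‖embed θ hθ F x‖ = tsirelsonNorm θ F x :=
  UniformSpace.Completion.norm_coe (E := C00 θ hθ F) x

theorem coord_embed (k : ℕ+) (x : ℕ+ →₀ ℝ) : coord k (embed θ hθ F x) = x k :=
  ContinuousLinearMap.extend_eq (coordC00 θ hθ F k)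
    UniformSpace.Completion.denseRange_coe (UniformSpace.Completion.isUniformInducing_coe _) x

theorem embed_single (k : ℕ+) (c : ℝ) :
    embed θ hθ F (Finsupp.single k c) = c • unitVec θ hθ F k := by
  rw [← Finsupp.smul_single_one, map_smul]
  rfl

theorem coord_unitVec (k j : ℕ+) : coord k (unitVec θ hθ F j) = if k = j then 1 else 0 := by
  rw [← one_smul ℝ (unitVec θ hθ F j), ← embed_single, coord_embed, Finsupp.single_apply]
  simp only [eq_comm]

@[simp] theorem coord_unitVec_self (k : ℕ+) : coord k (unitVec θ hθ F k) = 1 := by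
  simp [coord_unitVec]

theorem abs_coord_le (k : ℕ+) (x : Space θ hθ F) : |coord k x| ≤ ‖x‖ := by
  refine embed_induction (isClosed_le (coord k).continuous.abs continuous_norm) (fun x => ?_) x
  rw [coord_embed, norm_embed]
  exact abs_le_tsirelsonNorm hθ F x k

theorem coord_restr (k : ℕ+) (E : Finset ℕ+) (x : Space θ hθ F) :
    coord k (restr E x) = if k ∈ E then coord k x else 0 := by
  simp [restr_apply, coord_unitVec]

theorem restr_unitVec (E : Finset ℕ+) (k : ℕ+) :
    restr E (unitVec θ hθ F k) = if k ∈ E then unitVec θ hθ F k else 0 := by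
  simp [restr_apply, coord_unitVec]

theorem restr_congr {E : Finset ℕ+} {x y : Space θ hθ F} (h : ∀ k ∈ E, coord k x = coord k y) :
    restr E x = restr E y := by
  rw [restr_apply, restr_apply]
  exact Finset.sum_congr rfl fun k hk => by rw [h k hk]

theorem restr_embed (E : Finset ℕ+) (x : ℕ+ →₀ ℝ) :
    restr E (embed θ hθ F x) = embed θ hθ F (proj E x) := by
  have : proj E x = ∑ k ∈ E, Finsupp.single k (x k) := by
    ext k
    simp [proj, Finsupp.filter_apply, Finsupp.finsetSum_apply, Finsupp.single_apply]
  rw [this, map_sum]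
  simp only [restr_apply, coord_embed, embed_single]

theorem restr_eq_embed (E : Finset ℕ+) (x : Space θ hθ F) :
    restr E x = embed θ hθ F (∑ k ∈ E, Finsupp.single k (coord k x)) := by
  simp only [map_sum, restr_apply, embed_single]

theorem norm_restr_le (E : Finset ℕ+) (x : Space θ hθ F) : ‖restr E x‖ ≤ ‖x‖ := by
  refine embed_induction (isClosed_le (restr E).continuous.norm continuous_norm) (fun x => ?_) x
  rw [restr_embed, norm_embed, norm_embed]
  exact tsirelsonNorm_le_of_abs_le hθ F (abs_proj_le E x)

theorem norm_sub_restr_le (E : Finset ℕ+) (x : Space θ hθ F) : ‖x - restr E x‖ ≤ ‖x‖ := by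
  refine embed_induction (p := fun x => ‖x - restr E x‖ ≤ ‖x‖)
    (isClosed_le (continuous_id.sub (restr E).continuous).norm continuous_norm) (fun x => ?_) x
  rw [restr_embed, ← map_sub, norm_embed, norm_embed]
  refine tsirelsonNorm_le_of_abs_le hθ F fun k => ?_
  rw [Finsupp.sub_apply, proj, Finsupp.filter_apply]
  split_ifs <;> simp

theorem restr_restr (E E' : Finset ℕ+) (x : Space θ hθ F) :
    restr E (restr E' x) = restr (E ∩ E') x := by
  simp only [restr_apply E, restr_apply (E ∩ E'), coord_restr, ite_smul, zero_smul]
  rw [← Finset.sum_filter, Finset.filter_mem_eq_inter]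

theorem norm_restr_mono {E E' : Finset ℕ+} (h : E ⊆ E') (x : Space θ hθ F) :
    ‖restr E x‖ ≤ ‖restr E' x‖ := by
  have := norm_restr_le E (restr E' x)
  rwa [restr_restr, Finset.inter_eq_left.2 h] at this

theorem tendsto_restr (x : Space θ hθ F) : Tendsto (fun E => restr E x) atTop (𝓝 x) := by
  rw [Metric.tendsto_atTop]
  intro ε hε
  obtain ⟨y, hy⟩ : ∃ y : ℕ+ →₀ ℝ, dist x (embed θ hθ F y) < ε :=
    (UniformSpace.Completion.denseRange_coe (α := C00 θ hθ F)).exists_dist_lt x hε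
  refine ⟨y.support, fun E hE => ?_⟩
  have hproj : proj E y = y := by
    ext k
    rw [proj, Finsupp.filter_apply, ite_eq_left_iff]
    exact fun hk => (Finsupp.notMem_support_iff.1 fun hk' => hk (hE hk')).symm
  have hle := norm_sub_restr_le E (x - embed θ hθ F y)
  rw [map_sub, restr_embed, hproj, sub_sub_sub_cancel_right, ← dist_eq_norm, ← dist_eq_norm] at hle
  rw [dist_comm]
  exact hle.trans_lt hy

theorem hasSum_coord (x : Space θ hθ F) : HasSum (fun k => coord k x • unitVec θ hθ F k) x :=
  (tendsto_restr x).congr fun E => restr_apply E x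

theorem ext_coord {x y : Space θ hθ F} (h : ∀ k, coord k x = coord k y) : x = y := by
  have hx := hasSum_coord x
  simp only [h] at hx
  exact hx.unique (hasSum_coord y)

theorem coord_eq_of_hasSum {a : ℕ+ → ℝ} {x : Space θ hθ F}
    (h : HasSum (fun i => a i • unitVec θ hθ F i) x) (k : ℕ+) : coord k x = a k := by
  have hsingle := hasSum_single (f := fun i => coord k (a i • unitVec θ hθ F i)) k fun i hi => by
    simp [coord_unitVec, hi.symm]
  simpa using (h.mapL (coord k)).unique hsingle

theorem existsUnique_hasSum (x : Space θ hθ F) :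
    ∃! a : ℕ+ → ℝ, HasSum (fun i => a i • unitVec θ hθ F i) x :=
  ⟨fun k => coord k x, hasSum_coord x, fun _ ha => funext fun k => (coord_eq_of_hasSum ha k).symm⟩

theorem norm_le_of_norm_restr_le {x : Space θ hθ F} {b : ℝ} (h : ∀ E, ‖restr E x‖ ≤ b) :
    ‖x‖ ≤ b :=
  le_of_tendsto' (tendsto_restr x).norm h

theorem norm_le_of_abs_coord_le {x y : Space θ hθ F} (h : ∀ k, |coord k x| ≤ |coord k y|) :
    ‖x‖ ≤ ‖y‖ := by
  refine norm_le_of_norm_restr_le fun E => le_trans ?_ (norm_restr_le E y)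
  rw [restr_eq_embed, restr_eq_embed, norm_embed, norm_embed]
  refine tsirelsonNorm_le_of_abs_le hθ F fun k => ?_
  rw [← coord_embed (θ := θ) (hθ := hθ) (F := F), ← coord_embed (θ := θ) (hθ := hθ) (F := F),
    ← restr_eq_embed, ← restr_eq_embed, coord_restr, coord_restr]
  split_ifs
  · exact h k
  · exact le_rfl

theorem tendsto_restr_of_tendsto_coord {ι : Type*} {l : Filter ι} {x : ι → Space θ hθ F}
    {z : Space θ hθ F} (h : ∀ k, Tendsto (fun i => coord k (x i)) l (𝓝 (coord k z)))
    (E : Finset ℕ+) : Tendsto (fun i => restr E (x i)) l (𝓝 (restr E z)) := by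
  simp only [restr_apply]
  exact tendsto_finsetSum _ fun k _ => (h k).smul_const _

theorem norm_le_of_tendsto_coord {ι : Type*} {l : Filter ι} [l.NeBot] {x : ι → Space θ hθ F}
    {z : Space θ hθ F} {b : ℝ} (h : ∀ k, Tendsto (fun i => coord k (x i)) l (𝓝 (coord k z)))
    (hb : ∀ᶠ i in l, ‖x i‖ ≤ b) : ‖z‖ ≤ b :=
  norm_le_of_norm_restr_le fun E => le_of_tendsto (tendsto_restr_of_tendsto_coord h E).norm
    (hb.mono fun i hi => (norm_restr_le E (x i)).trans hi)

theorem norm_unitVec (k : ℕ+) : ‖unitVec θ hθ F k‖ = 1 := by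
  refine le_antisymm ?_ (by simpa using abs_coord_le k (unitVec θ hθ F k))
  rw [← one_smul ℝ (unitVec θ hθ F k), ← embed_single, norm_embed]
  refine ((isGood_tsirelsonNorm hθ F).le_l1 _).trans ?_
  refine (Finset.sum_le_sum_of_subset_of_nonneg Finsupp.support_single_subset
    fun _ _ _ => abs_nonneg _).trans ?_
  simp

theorem tendsto_coord_cofinite (x : Space θ hθ F) :
    Tendsto (fun k => coord k x) cofinite (𝓝 0) := by
  have h := (hasSum_coord x).summable.tendsto_cofinite_zero.norm
  simp only [norm_smul, norm_unitVec, mul_one, norm_zero] at h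
  exact tendsto_zero_iff_norm_tendsto_zero.2 h

/-! ### The implicit equation for the norm -/

theorem sum_restr_le {d : ℕ} {E : Fin d → Finset ℕ+} (hE : Admissible F E) (x : Space θ hθ F) :
    θ * ∑ i, ‖restr (E i) x‖ ≤ ‖x‖ := by
  refine embed_induction (p := fun x => θ * ∑ i, ‖restr (E i) x‖ ≤ ‖x‖)
    (isClosed_le (by fun_prop) continuous_norm) (fun x => ?_) x
  simp_rw [restr_embed, norm_embed]
  exact sum_proj_le_tsirelsonNorm hθ hE x

theorem norm_le {x : Space θ hθ F} {b : ℝ} (hcoord : ∀ k, |coord k x| ≤ b)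
    (hsum : ∀ (d : ℕ) (E : Fin d → Finset ℕ+), Admissible F E →
      θ * ∑ i, ‖restr (E i) x‖ ≤ b) : ‖x‖ ≤ b := by
  have hb : 0 ≤ b := (abs_nonneg _).trans (hcoord 1)
  refine norm_le_of_norm_restr_le fun A => ?_
  rw [restr_eq_embed, norm_embed]
  refine tsirelsonNorm_le hθ (fun k => ?_) fun d E hE => ?_
  · rw [← coord_embed (θ := θ) (hθ := hθ) (F := F), ← restr_eq_embed, coord_restr]
    split_ifs
    · exact hcoord k
    · simpa using hb
  · refine le_trans (mul_le_mul_of_nonneg_left (Finset.sum_le_sum fun i _ => ?_) hθ.1.le)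
      (hsum d E hE)
    rw [← norm_embed (hθ := hθ), ← restr_embed, ← restr_eq_embed, restr_restr]
    exact norm_restr_mono Finset.inter_subset_left x

theorem exists_admissible_lt {x : Space θ hθ F} {c : ℝ} (hcoord : ∀ k, |coord k x| ≤ c)
    (hc : c < ‖x‖) :
    ∃ (d : ℕ) (E : Fin d → Finset ℕ+), Admissible F E ∧ c < θ * ∑ i, ‖restr (E i) x‖ := by
  by_contra! hcon
  exact hc.not_ge (norm_le hcoord hcon)

theorem Consecutive.eq_of_mem {d : ℕ} {E : Fin d → Finset ℕ+} (hE : Consecutive E) {i j : Fin d}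
    {k : ℕ+} (hi : k ∈ E i) (hj : k ∈ E j) : i = j := by
  by_contra hij
  rcases lt_or_gt_of_ne hij with h | h
  · exact lt_irrefl _ (hE.before _ _ h k hi k hj)
  · exact lt_irrefl _ (hE.before _ _ h k hj k hi)

theorem Consecutive.sum_ite_mem_le {d : ℕ} {E : Fin d → Finset ℕ+} (hE : Consecutive E) (k : ℕ+)
    {c : ℝ} (hc : 0 ≤ c) : (∑ i, if k ∈ E i then c else 0) ≤ c := by
  by_cases h : ∃ i, k ∈ E i
  · obtain ⟨i, hi⟩ := h
    rw [Finset.sum_eq_single i (fun j _ hji => if_neg fun hj => hji (hE.eq_of_mem hj hi))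
      (by simp), if_pos hi]
  · push Not at h
    simpa [h] using hc

theorem coord_sum_smul (A : Finset ℕ+) (a : ℕ+ → ℝ) (k : ℕ+) :
    coord k (∑ k ∈ A, a k • unitVec θ hθ F k) = if k ∈ A then a k else 0 := by
  simp [coord_unitVec]

theorem norm_smul_unitVec (c : ℝ) (k : ℕ+) : ‖c • unitVec θ hθ F k‖ = |c| := by
  rw [norm_smul, norm_unitVec, mul_one, Real.norm_eq_abs]

theorem norm_restr_smul_unitVec (E : Finset ℕ+) (c : ℝ) (k : ℕ+) :
    ‖restr E (c • unitVec θ hθ F k)‖ = if k ∈ E then |c| else 0 := by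
  rw [map_smul, restr_unitVec]
  split_ifs
  · exact norm_smul_unitVec c k
  · rw [smul_zero, norm_zero]

theorem norm_sum_smul_le {A : Finset ℕ+} {a : ℕ+ → ℝ} {b : ℝ}
    (hb : 0 ≤ b) (hcoord : ∀ k ∈ A, |a k| ≤ b) (hsum : θ * ∑ k ∈ A, |a k| ≤ b) :
    ‖∑ k ∈ A, a k • unitVec θ hθ F k‖ ≤ b := by
  refine norm_le (fun k => ?_) fun d E hE => ?_
  · rw [coord_sum_smul]
    split_ifs with h
    · exact hcoord k h
    · simpa using hb
  · refine le_trans (mul_le_mul_of_nonneg_left ?_ hθ.1.le) hsum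
    calc ∑ i, ‖restr (E i) (∑ k ∈ A, a k • unitVec θ hθ F k)‖
        ≤ ∑ i, ∑ k ∈ A, ‖restr (E i) (a k • unitVec θ hθ F k)‖ :=
          Finset.sum_le_sum fun i _ => by rw [map_sum]; exact norm_sum_le _ _
      _ = ∑ k ∈ A, ∑ i, if k ∈ E i then |a k| else 0 := by
          rw [Finset.sum_comm]
          simp only [norm_restr_smul_unitVec]
      _ ≤ ∑ k ∈ A, |a k| :=
          Finset.sum_le_sum fun k _ => hE.1.sum_ite_mem_le k (abs_nonneg _)

theorem norm_add_smul_unitVec_le (y : Space θ hθ F) (c : ℝ) (i : ℕ+) :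
    ‖y + c • unitVec θ hθ F i‖ ≤ max |coord i y + c| (θ * |c| + ‖y‖) := by
  have hc : 0 ≤ θ * |c| := mul_nonneg hθ.1.le (abs_nonneg c)
  refine norm_le (fun k => ?_) fun d E hE => le_max_of_le_right ?_
  · rw [map_add, map_smul, coord_unitVec, smul_eq_mul]
    split_ifs with h
    · rw [h, mul_one]
      exact le_max_left _ _
    · rw [mul_zero, add_zero]
      exact le_max_of_le_right ((abs_coord_le k y).trans (by linarith))
  · calc θ * ∑ j, ‖restr (E j) (y + c • unitVec θ hθ F i)‖
        ≤ θ * ∑ j, (‖restr (E j) y‖ + if i ∈ E j then |c| else 0) := by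
          refine mul_le_mul_of_nonneg_left (Finset.sum_le_sum fun j _ => ?_) hθ.1.le
          rw [← norm_restr_smul_unitVec (θ := θ) (hθ := hθ) (F := F), map_add]
          exact norm_add_le _ _
      _ ≤ θ * (∑ j, ‖restr (E j) y‖ + |c|) := by
          rw [Finset.sum_add_distrib]
          exact mul_le_mul_of_nonneg_left
            (add_le_add_right (hE.1.sum_ite_mem_le i (abs_nonneg c)) _) hθ.1.le
      _ ≤ θ * |c| + ‖y‖ := by
          rw [mul_add, add_comm]
          exact add_le_add_right (sum_restr_le hE y) _

theorem norm_smul_unitVec_add_smul_unitVec {i j : ℕ+} (hij : i ≠ j) {s t : ℝ} (hs : |s| = 1)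
    (ht : |t| = 1) : ‖s • unitVec θ hθ F i + t • unitVec θ hθ F j‖ = 1 := by
  refine le_antisymm ?_ ?_
  · have h := norm_sum_smul_le (θ := θ) (hθ := hθ) (F := F) (A := {i, j})
      (a := fun k => if k = i then s else t) zero_le_one ?_ ?_
    · rwa [Finset.sum_pair hij, if_pos rfl, if_neg hij.symm] at h
    · intro k _
      split_ifs <;> simp [hs, ht]
    · rw [Finset.sum_pair hij, if_pos rfl, if_neg hij.symm, hs, ht]
      linarith [hθ.2]
  · have := abs_coord_le i (s • unitVec θ hθ F i + t • unitVec θ hθ F j)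
    simpa [coord_unitVec, hij, hs] using this

end Space

/-! ### Tails and limits -/

section Admissible

variable {F : Set (Finset ℕ+)} {d : ℕ}

theorem Admissible.init_snoc (hF : HereditarySpreading F) {E : Fin (d + 1) → Finset ℕ+}
    (hE : Admissible F E) {k : ℕ+} (hk : k ∈ E (Fin.last d)) {B : Finset ℕ+} (hB : B.Nonempty)
    (hkB : ∀ b ∈ B, k ≤ b) :
    Admissible F (Fin.snoc (fun i : Fin d => E i.castSucc) B : Fin (d + 1) → Finset ℕ+) := by
  obtain ⟨hcons, hmin⟩ := hE
  have hcons' := hcons.castSucc.snoc hB fun i a ha b hb =>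
    (hcons.before _ _ (Fin.castSucc_lt_last i) a ha k hk).trans_le (hkB b hb)
  refine ⟨hcons',
    hF.image_mem_of_le hcons.strictMono_min' hcons'.strictMono_min' (fun i => ?_) hmin⟩
  refine Finset.le_min' _ _ _ fun a ha => ?_
  cases i using Fin.lastCases with
  | last => exact (Finset.min'_le _ _ hk).trans (hkB a (by simpa only [Fin.snoc_last] using ha))
  | cast i => exact Finset.min'_le _ _ (by simpa only [Fin.snoc_castSucc] using ha)

theorem admissible_singleton {g : Fin d → ℕ+} (hg : StrictMono g)
    (hgF : Finset.univ.image g ∈ F) : Admissible F fun i => {g i} :=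
  ⟨⟨fun _ => Finset.singleton_nonempty _, fun i j hij a ha b hb => by
    rw [Finset.mem_singleton.1 ha, Finset.mem_singleton.1 hb]
    exact hg hij⟩, by simpa only [Finset.min'_singleton] using hgF⟩

theorem Consecutive.admissible (hS : firstSchreier ⊆ F) {E : Fin d → Finset ℕ+}
    (hE : Consecutive E) (hd : ∀ i, ∀ k ∈ E i, d ≤ (k : ℕ)) : Admissible F E := by
  refine ⟨hE, hS fun k hk => ?_⟩
  obtain ⟨i, -, rfl⟩ := Finset.mem_image.1 hk
  refine Finset.card_image_le.trans ?_
  rw [Finset.card_fin]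
  exact hd i _ (Finset.min'_mem _ _)

theorem exists_consecutive_of_frequently {P : Finset ℕ+ → Prop}
    (hP : ∀ M : ℕ+, ∃ G, G.Nonempty ∧ P G ∧ ∀ k ∈ G, M ≤ k) (R : ℕ+) (d : ℕ) :
    ∃ E : Fin d → Finset ℕ+, Consecutive E ∧ ∀ i, P (E i) ∧ ∀ k ∈ E i, R ≤ k := by
  induction d with
  | zero => exact ⟨Fin.elim0, ⟨fun i => i.elim0, fun i => i.elim0⟩, fun i => i.elim0⟩
  | succ d ih =>
    obtain ⟨E, hE, hPE⟩ := ih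
    obtain ⟨M, hM⟩ := (Finset.univ.biUnion E).exists_le
    obtain ⟨G, hG, hPG, hRG⟩ := hP (max R (M + 1))
    refine ⟨Fin.snoc E G, hE.snoc hG fun i a ha b hb => ?_, fun i => ?_⟩
    · have haM : a ≤ M := hM a (Finset.mem_biUnion.2 ⟨i, Finset.mem_univ i, ha⟩)
      exact (PNat.lt_add_one_iff.2 haM).trans_le ((le_max_right _ _).trans (hRG b hb))
    · cases i using Fin.lastCases with
      | last =>
        simpa only [Fin.snoc_last] using ⟨hPG, fun k hk => (le_max_left _ _).trans (hRG k hk)⟩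
      | cast i => simpa only [Fin.snoc_castSucc] using hPE i

end Admissible

section Tails

variable {θ : ℝ} {hθ : θ ∈ Set.Ioc (0 : ℝ) (1 / 2)} {F : Set (Finset ℕ+)}

/-- The projection of `T[θ, F]` onto the coordinates from `M` on. -/
def tail (M : ℕ+) : Space θ hθ F →L[ℝ] Space θ hθ F :=
  ContinuousLinearMap.id ℝ _ - restr (Finset.Ico 1 M)

theorem tail_apply (M : ℕ+) (x : Space θ hθ F) : tail M x = x - restr (Finset.Ico 1 M) x := rfl

theorem coord_tail (k M : ℕ+) (x : Space θ hθ F) :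
    coord k (tail M x) = if M ≤ k then coord k x else 0 := by
  rw [tail_apply, map_sub, coord_restr]
  by_cases h : M ≤ k
  · simp [h]
  · simp [h, not_le.1 h]

theorem norm_tail_le (M : ℕ+) (x : Space θ hθ F) : ‖tail M x‖ ≤ ‖x‖ := norm_sub_restr_le _ _

theorem norm_tail_anti {M M' : ℕ+} (h : M ≤ M') (x : Space θ hθ F) : ‖tail M' x‖ ≤ ‖tail M x‖ := by
  refine norm_le_of_abs_coord_le fun k => ?_
  rw [coord_tail, coord_tail]
  split_ifs with h₁ h₂
  · exact le_rfl
  · exact absurd (h.trans h₁) h₂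
  · exact abs_zero.trans_le (abs_nonneg _)
  · exact le_rfl

theorem norm_restr_tail_le {E B : Finset ℕ+} {M : ℕ+} (h : ∀ k ∈ E, M ≤ k → k ∈ B)
    (x : Space θ hθ F) : ‖restr E (tail M x)‖ ≤ ‖restr B x‖ := by
  refine norm_le_of_abs_coord_le fun k => ?_
  rw [coord_restr, coord_restr, coord_tail]
  split_ifs with hE hM hB
  · exact le_rfl
  · exact absurd (h k hE hM) hB
  all_goals exact abs_zero.trans_le (abs_nonneg _)

theorem exists_norm_tail_lt (x : Space θ hθ F) {ε : ℝ} (hε : 0 < ε) : ∃ M : ℕ+, ‖tail M x‖ < ε := by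
  obtain ⟨s, hs⟩ := Metric.tendsto_atTop.1 (tendsto_restr x) ε hε
  obtain ⟨M, hM⟩ := s.exists_le
  refine ⟨M + 1, ?_⟩
  have := hs (Finset.Ico 1 (M + 1)) fun k hk =>
    Finset.mem_Ico.2 ⟨one_le, PNat.lt_add_one_iff.2 (hM k hk)⟩
  rwa [dist_comm, dist_eq_norm, ← tail_apply] at this

theorem sum_restr_add_tail_le (hF : HereditarySpreading F) {d : ℕ} {E : Fin (d + 1) → Finset ℕ+}
    (hE : Admissible F E) {k M : ℕ+} (hk : k ∈ E (Fin.last d)) (hkM : k ≤ M) (x : Space θ hθ F) :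
    θ * (∑ i : Fin d, ‖restr (E i.castSucc) x‖ + ‖tail M x‖) ≤ ‖x‖ := by
  have hfinite : ∀ A : Finset ℕ+,
      θ * (∑ i : Fin d, ‖restr (E i.castSucc) x‖ + ‖restr A (tail M x)‖) ≤ ‖x‖ := by
    intro A
    have hadm := hE.init_snoc hF hk (B := insert M (A.filter (M ≤ ·))) (Finset.insert_nonempty _ _)
      (Finset.forall_mem_insert _ _ _ |>.2 ⟨hkM, fun b hb => hkM.trans (Finset.mem_filter.1 hb).2⟩)
    have hsum := sum_restr_le hadm x
    simp only [Fin.sum_univ_castSucc, Fin.snoc_castSucc, Fin.snoc_last] at hsum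
    refine le_trans (mul_le_mul_of_nonneg_left (add_le_add_right ?_ _) hθ.1.le) hsum
    exact norm_restr_tail_le
      (fun k hk hM => Finset.mem_insert_of_mem (Finset.mem_filter.2 ⟨hk, hM⟩)) x
  exact le_of_tendsto' (((tendsto_restr (tail M x)).norm.const_add _).const_mul θ) hfinite

/-- The unit vector basis is boundedly complete: otherwise there are arbitrarily many consecutive
blocks of norm at least `ε`, lying so far out that they form an admissible family. -/
theorem summable_of_bounded (hS : firstSchreier ⊆ F)
    {w : ℕ+ → ℝ} {C : ℝ} (hw : ∀ A : Finset ℕ+, ‖∑ k ∈ A, w k • unitVec θ hθ F k‖ ≤ C) :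
    Summable fun k => w k • unitVec θ hθ F k := by
  rw [summable_iff_vanishing_norm]
  by_contra! hcon
  obtain ⟨ε, hε, hcon⟩ := hcon
  have hblock : ∀ M : ℕ+, ∃ G : Finset ℕ+, G.Nonempty ∧
      ε ≤ ‖∑ k ∈ G, w k • unitVec θ hθ F k‖ ∧ ∀ k ∈ G, M ≤ k := by
    intro M
    obtain ⟨G, hG, hεG⟩ := hcon (Finset.Ico 1 M)
    refine ⟨G, ?_, hεG, fun k hk => ?_⟩
    · rw [Finset.nonempty_iff_ne_empty]
      rintro rfl
      rw [Finset.sum_empty, norm_zero] at hεG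
      exact hε.not_ge hεG
    · by_contra! h
      exact Finset.disjoint_left.1 hG hk (Finset.mem_Ico.2 ⟨one_le, h⟩)
  obtain ⟨d, hd⟩ := exists_nat_gt (C / (θ * ε))
  obtain ⟨E, hE, hEε⟩ := exists_consecutive_of_frequently hblock d.succPNat d
  have hadm : Admissible F E := hE.admissible hS fun i k hk =>
    d.le_succ.trans (PNat.coe_le_coe _ _ |>.2 ((hEε i).2 k hk))
  set x := ∑ k ∈ Finset.univ.biUnion E, w k • unitVec θ hθ F k with hx
  have hrestr : ∀ i, ε ≤ ‖restr (E i) x‖ := by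
    intro i
    refine (hEε i).1.trans_eq (congrArg norm ?_)
    rw [restr_apply]
    refine Finset.sum_congr rfl fun k hk => ?_
    rw [hx, coord_sum_smul, if_pos (Finset.mem_biUnion.2 ⟨i, Finset.mem_univ i, hk⟩)]
  have hle : θ * (d * ε) ≤ C := by
    refine le_trans (mul_le_mul_of_nonneg_left ?_ hθ.1.le) ((sum_restr_le hadm x).trans (hw _))
    simpa using
      Finset.card_nsmul_le_sum Finset.univ (fun i => ‖restr (E i) x‖) ε fun i _ => hrestr i
  rw [div_lt_iff₀ (mul_pos hθ.1 hε)] at hd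
  linarith

theorem exists_abs_coord_le {p : Space θ hθ F} (hp : ∀ k, |coord k p| < 1) :
    ∃ b < 1, ∀ k, |coord k p| ≤ b := by
  have hfin : {k | ¬ |coord k p| < 1 / 2}.Finite :=
    (tendsto_coord_cofinite p).abs.eventually_lt_const (show |(0 : ℝ)| < 1 / 2 by norm_num)
  obtain ⟨k₀, -, hk₀⟩ := (insert 1 hfin.toFinset).exists_max_image (fun k => |coord k p|)
    ⟨1, Finset.mem_insert_self _ _⟩
  refine ⟨max (1 / 2) |coord k₀ p|, max_lt (by norm_num) (hp k₀), fun k => ?_⟩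
  by_cases hk : |coord k p| < 1 / 2
  · exact le_max_of_le_left hk.le
  · exact le_max_of_le_right (hk₀ k (Finset.mem_insert_of_mem (hfin.mem_toFinset.2 hk)))

section NullSequence

variable {ι : Type*} {l : Filter ι} [l.NeBot] {u : ι → Space θ hθ F} {p : Space θ hθ F} {b : ℝ}

/-- For late `i`, the part of `u i` beyond the support of `p` can serve as the last block of an
admissible family. -/
theorem sum_restr_add_one_le_of_eventually_norm_sub_le (hF : HereditarySpreading F)
    (hu1 : ∀ i, ‖u i‖ = 1) (hu : ∀ k, Tendsto (fun i => coord k (u i)) l (𝓝 0)) {d : ℕ}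
    {E : Fin (d + 1) → Finset ℕ+} (hE : Admissible F E) (hpu : ∀ᶠ i in l, ‖p - u i‖ ≤ b) :
    θ * (∑ j : Fin d, ‖restr (E j.castSucc) p‖ + 1) ≤ b := by
  have hnull : ∀ A, Tendsto (fun i => restr A (u i)) l (𝓝 0) := fun A => by
    simpa only [map_zero] using tendsto_restr_of_tendsto_coord (z := (0 : Space θ hθ F))
      (fun k => by simpa only [map_zero] using hu k) A
  obtain ⟨k, hk⟩ := hE.1.nonempty (Fin.last d)
  refine le_of_forall_pos_sub_le fun ε hε => ?_
  obtain ⟨K', hK'⟩ := exists_norm_tail_lt p hε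
  set K := max k K'
  have hK : ‖tail K p‖ ≤ ε := (norm_tail_anti (le_max_right k K') p).trans hK'.le
  have hbound : ∀ᶠ i in l, θ * (∑ j : Fin d, ‖restr (E j.castSucc) p - restr (E j.castSucc) (u i)‖ +
      (1 - ‖restr (Finset.Ico 1 K) (u i)‖ - ‖tail K p‖)) ≤ b := by
    filter_upwards [hpu] with i hi
    refine le_trans (mul_le_mul_of_nonneg_left ?_ hθ.1.le)
      ((sum_restr_add_tail_le hF hE hk (le_max_left k K') (p - u i)).trans hi)
    simp only [map_sub]
    refine add_le_add_right ?_ _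
    have hui : 1 - ‖restr (Finset.Ico 1 K) (u i)‖ ≤ ‖tail K (u i)‖ :=
      hu1 i ▸ norm_sub_norm_le _ _
    have := norm_sub_norm_le (tail K (u i)) (tail K p)
    rw [norm_sub_rev] at this
    linarith
  have hlim : Tendsto (fun i => θ * (∑ j : Fin d,
      ‖restr (E j.castSucc) p - restr (E j.castSucc) (u i)‖ +
        (1 - ‖restr (Finset.Ico 1 K) (u i)‖ - ‖tail K p‖))) l
      (𝓝 (θ * (∑ j : Fin d, ‖restr (E j.castSucc) p - 0‖ +
        (1 - ‖(0 : Space θ hθ F)‖ - ‖tail K p‖)))) :=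
    ((tendsto_finsetSum _ fun j _ => ((hnull _).const_sub _).norm).add
      (((hnull _).norm.const_sub 1).sub_const _)).const_mul θ
  have := le_of_tendsto hlim hbound
  simp only [sub_zero, norm_zero] at this
  nlinarith [hθ.1, hθ.2, norm_nonneg (tail K p)]

theorem exists_norm_tail_eq_one (hp : ‖p‖ = 1) :
    ∃ M : ℕ+, ‖tail M p‖ = 1 ∧ ‖tail (M + 1) p‖ < 1 := by
  have hex := exists_norm_tail_lt p one_pos
  have hone : 1 < PNat.find hex := by
    rw [PNat.lt_find_iff]
    intro m hm
    rw [le_antisymm hm one_le, tail_apply, Finset.Ico_self, restr_apply, Finset.sum_empty, sub_zero,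
      hp]
    exact lt_irrefl _
  obtain ⟨M, hM⟩ : ∃ M, PNat.find hex = M + 1 := ⟨_, (PNat.sub_add_of_lt hone).symm⟩
  refine ⟨M, le_antisymm ((norm_tail_le M p).trans hp.le) ?_, hM ▸ PNat.find_spec hex⟩
  exact not_lt.1 (PNat.find_min hex (hM ▸ PNat.lt_add_right M 1))

theorem exists_admissible_one_lt (hp : ‖p‖ = 1) (hcoord : ∀ k, |coord k p| < 1) :
    ∃ (d : ℕ) (E : Fin (d + 1) → Finset ℕ+), Admissible F E ∧
      1 < θ * (∑ j : Fin d, ‖restr (E j.castSucc) p‖ + 1) := by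
  obtain ⟨M, hM, hM'⟩ := exists_norm_tail_eq_one hp
  obtain ⟨b, hb, hpb⟩ := exists_abs_coord_le hcoord
  have hb0 : 0 ≤ b := (abs_nonneg _).trans (hpb 1)
  set η := 1 - ‖tail (M + 1) p‖ with hη
  have hθη : 0 < θ * η := mul_pos hθ.1 (sub_pos.2 hM')
  obtain ⟨d, E, hE, hsum⟩ := exists_admissible_lt (x := tail M p) (c := max b (1 - θ * η))
    (fun k => by
      rw [coord_tail]
      split_ifs
      · exact le_max_of_le_left (hpb k)
      · exact abs_zero.trans_le (le_max_of_le_left hb0))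
    (hM.symm ▸ max_lt hb (by linarith))
  replace hsum := (le_max_right _ _).trans_lt hsum
  have hθη' : θ * η ≤ 1 / 2 := by nlinarith [hθ.1, hθ.2, norm_nonneg (tail (M + 1) p)]
  obtain _ | d := d
  · rw [Finset.univ_eq_empty, Finset.sum_empty] at hsum
    linarith
  rw [Fin.sum_univ_castSucc] at hsum
  have hlast : ∀ k ∈ E (Fin.last d), M < k := by
    by_contra! hk
    obtain ⟨k, hk, hkM⟩ := hk
    have hzero : ∀ i : Fin d, restr (E i.castSucc) (tail M p) = 0 := fun i => by
      rw [restr_congr (y := 0) fun a ha => ?_, map_zero]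
      rw [coord_tail, if_neg, map_zero]
      exact not_le.2 ((hE.1.before _ _ (Fin.castSucc_lt_last i) a ha k hk).trans_le hkM)
    simp only [hzero, norm_zero, Finset.sum_const_zero, zero_add] at hsum
    nlinarith [hθ.1, hθ.2, (norm_restr_le (E (Fin.last d)) (tail M p)).trans hM.le]
  have hlast' : ‖restr (E (Fin.last d)) (tail M p)‖ ≤ 1 - η := by
    rw [hη, sub_sub_cancel, restr_congr (y := tail (M + 1) p) fun k hk => ?_]
    · exact norm_restr_le _ _
    · rw [coord_tail, coord_tail, if_pos (hlast k hk).le,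
        if_pos (PNat.add_one_le_iff.2 (hlast k hk))]
  have hinit := Finset.sum_le_sum fun (j : Fin d) (_ : j ∈ Finset.univ) =>
    norm_restr_tail_le (M := M) (fun k hk _ => hk) (E := E j.castSucc) p
  exact ⟨d, E, hE, by nlinarith [hθ.1]⟩

theorem exists_abs_coord_eq_one_of_norm_sub_le (hF : HereditarySpreading F)
    (hu1 : ∀ i, ‖u i‖ = 1) (hu : ∀ k, Tendsto (fun i => coord k (u i)) l (𝓝 0)) (hp : ‖p‖ = 1)
    (hpu : ∀ᶠ i in l, ‖p - u i‖ ≤ 1) : ∃ k, |coord k p| = 1 := by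
  by_contra! hcon
  obtain ⟨d, E, hE, hlt⟩ := exists_admissible_one_lt hp fun k =>
    lt_of_le_of_ne (hp ▸ abs_coord_le k p) (hcon k)
  exact hlt.not_ge (sum_restr_add_one_le_of_eventually_norm_sub_le hF hu1 hu hE hpu)

end NullSequence

end Tails

/-! ### Centres of symmetry of bounded metric spaces -/

section CentreOfSymmetry

variable {Y Y' : Type*} [MetricSpace Y] [MetricSpace Y']

/-- Conjugating the reflection by an isometry `g` produces an isometry that moves `c` twice as far
as `g` does, so the displacements of `c`, being bounded, all vanish. -/
theorem apply_center_eq {c : Y} (ρ : Y ≃ᵢ Y) (hρ : ∀ y, dist (ρ y) y = 2 * dist y c) {C : ℝ}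
    (hC : ∀ y, dist y c ≤ C) (g : Y ≃ᵢ Y) : g c = c := by
  have hρc : ρ c = c := by
    have := hρ c
    rwa [dist_self, mul_zero, dist_eq_zero] at this
  have hbdd : BddAbove (Set.range fun g : Y ≃ᵢ Y => dist (g c) c) :=
    ⟨C, by rintro _ ⟨g, rfl⟩; exact hC _⟩
  have hdouble : ∀ g : Y ≃ᵢ Y, 2 * dist (g c) c ≤ ⨆ g : Y ≃ᵢ Y, dist (g c) c := by
    intro g
    calc 2 * dist (g c) c = dist (ρ (g c)) (g c) := (hρ _).symm
      _ = dist (g (g.symm (ρ (g c)))) (g c) := by rw [g.apply_symm_apply]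
      _ = dist (ρ (g.symm (ρ (g c)))) (ρ c) := by rw [g.dist_eq, ρ.dist_eq]
      _ = dist (ρ (g.symm (ρ (g c)))) c := by rw [hρc]
      _ ≤ _ := le_ciSup hbdd (((g.trans ρ).trans g.symm).trans ρ)
  have hsup : (⨆ g : Y ≃ᵢ Y, dist (g c) c) ≤ (⨆ g : Y ≃ᵢ Y, dist (g c) c) / 2 :=
    ciSup_le fun g => by linarith [hdouble g]
  have hle := le_ciSup hbdd g
  have hnonneg : 0 ≤ dist (g c) c := dist_nonneg
  exact dist_eq_zero.1 (by linarith)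

theorem map_center_eq (h : Y ≃ᵢ Y') {c : Y} {c' : Y'} (ρ : Y ≃ᵢ Y)
    (hρ : ∀ y, dist (ρ y) y = 2 * dist y c) {C : ℝ} (hC : ∀ y, dist y c ≤ C) (ρ' : Y' ≃ᵢ Y')
    (hρ' : ∀ y, dist (ρ' y) y = 2 * dist y c') : h c = c' := by
  have hconj : h.symm (ρ' (h c)) = c := apply_center_eq ρ hρ hC ((h.trans ρ').trans h.symm)
  have hfix : ρ' (h c) = h c := by rw [← h.apply_symm_apply (ρ' (h c)), hconj]
  have hdist := hρ' (h c)
  rw [hfix, dist_self] at hdist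
  exact dist_eq_zero.1 (by linarith)

end CentreOfSymmetry

/-! ### Isometries of the unit sphere map vertices to vertices -/

section Sphere

variable {θ : ℝ} {hθ : θ ∈ Set.Ioc (0 : ℝ) (1 / 2)} {F : Set (Finset ℕ+)}

variable (θ hθ F) in
/-- The unit sphere of `T[θ, F]`. -/
abbrev Sphere : Type := Metric.sphere (0 : Space θ hθ F) 1

theorem norm_coe_sphere (x : Sphere θ hθ F) : ‖(x : Space θ hθ F)‖ = 1 :=
  mem_sphere_zero_iff_norm.1 x.2

theorem abs_coord_sphere_le (k : ℕ+) (x : Sphere θ hθ F) : |coord k (x : Space θ hθ F)| ≤ 1 :=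
  (abs_coord_le k _).trans (norm_coe_sphere x).le

theorem norm_sub_sphere_le (x y : Sphere θ hθ F) : ‖(x : Space θ hθ F) - y‖ ≤ 2 :=
  (norm_sub_le _ _).trans_eq (by rw [norm_coe_sphere, norm_coe_sphere, one_add_one_eq_two])

theorem norm_map_sub (U : Sphere θ hθ F ≃ᵢ Sphere θ hθ F) (x y : Sphere θ hθ F) :
    ‖(U x : Space θ hθ F) - U y‖ = ‖(x : Space θ hθ F) - y‖ := by
  simpa only [Subtype.dist_eq, dist_eq_norm] using U.dist_eq x y

theorem abs_neg_eq_one {s : ℝ} (hs : |s| = 1) : |-s| = 1 := by rwa [abs_neg]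

section Vertex

variable {s t : ℝ} (hs : |s| = 1) (ht : |t| = 1)

/-- The vector `s • e k`, as a point of the unit sphere. -/
def vertex (s : ℝ) (hs : |s| = 1) (k : ℕ+) : Sphere θ hθ F :=
  ⟨s • unitVec θ hθ F k, by rw [mem_sphere_zero_iff_norm, norm_smul_unitVec, hs]⟩

theorem coe_vertex (k : ℕ+) :
    ((vertex s hs k : Sphere θ hθ F) : Space θ hθ F) = s • unitVec θ hθ F k := rfl

theorem coord_vertex (i j : ℕ+) :
    coord j ((vertex s hs i : Sphere θ hθ F) : Space θ hθ F) = if j = i then s else 0 := by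
  rw [coe_vertex, map_smul, coord_unitVec, smul_eq_mul, mul_ite, mul_one, mul_zero]

theorem coord_vertex_self (i : ℕ+) :
    coord i ((vertex s hs i : Sphere θ hθ F) : Space θ hθ F) = s := by
  rw [coord_vertex, if_pos rfl]

theorem norm_vertex_sub_vertex {i j : ℕ+} (hij : i ≠ j) :
    ‖((vertex s hs i : Sphere θ hθ F) : Space θ hθ F) - (vertex t ht j : Sphere θ hθ F)‖ = 1 := by
  have := norm_smul_unitVec_add_smul_unitVec (θ := θ) (hθ := hθ) (F := F) hij hs (abs_neg_eq_one ht)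
  rwa [neg_smul, ← sub_eq_add_neg] at this

theorem norm_sub_eq_two (hs : |s| = 1) {x y : Sphere θ hθ F} {j : ℕ+}
    (hx : coord j (x : Space θ hθ F) = s) (hy : coord j (y : Space θ hθ F) = -s) :
    ‖(x : Space θ hθ F) - y‖ = 2 := by
  refine le_antisymm (norm_sub_sphere_le x y) ?_
  have := abs_coord_le j ((x : Space θ hθ F) - (y : Space θ hθ F))
  rwa [map_sub, hx, hy, sub_neg_eq_add, ← two_mul, abs_mul, hs, mul_one, abs_two] at this

theorem norm_sub_vertex_eq_two_iff {y : Sphere θ hθ F} {i : ℕ+} :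
    ‖(y : Space θ hθ F) - (vertex s hs i : Sphere θ hθ F)‖ = 2 ↔
      coord i (y : Space θ hθ F) = -s := by
  constructor
  · intro h
    have hmax := norm_add_smul_unitVec_le (y : Space θ hθ F) (-s) i
    rw [neg_smul, ← sub_eq_add_neg, ← coe_vertex hs, h, abs_neg, hs, norm_coe_sphere,
      le_max_iff] at hmax
    have habs : 2 ≤ |coord i (y : Space θ hθ F) + -s| :=
      hmax.resolve_right fun h => by linarith [hθ.2]
    have hy := abs_le.1 (abs_coord_sphere_le i y)
    rcases (abs_eq zero_le_one).1 hs with rfl | rfl <;> rcases le_abs.1 habs with h | h <;> linarith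
  · intro h
    rw [norm_sub_rev]
    exact norm_sub_eq_two hs (coord_vertex_self hs i) h

end Vertex

section Faces

variable {i j : ℕ+} {τ σ : ℝ} (hτ : |τ| = 1) (hσ : |σ| = 1)

theorem coord_eq_neg_of_coord_map_eq_neg (U : Sphere θ hθ F ≃ᵢ Sphere θ hθ F) (hσ : |σ| = 1)
    (h : coord j (U (vertex τ hτ i) : Space θ hθ F) = σ) {y : Sphere θ hθ F}
    (hy : coord j (U y : Space θ hθ F) = -σ) : coord i (y : Space θ hθ F) = -τ := by
  rw [← norm_sub_vertex_eq_two_iff hτ, ← norm_map_sub U, norm_sub_rev]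
  exact norm_sub_eq_two hσ h hy

theorem coord_symm_vertex_eq (U : Sphere θ hθ F ≃ᵢ Sphere θ hθ F)
    (h : coord j (U (vertex τ hτ i) : Space θ hθ F) = σ) :
    coord i (U.symm (vertex σ hσ j) : Space θ hθ F) = τ := by
  set z := U.symm (vertex σ hσ j) with hz
  have hnorm : ‖((-z : Sphere θ hθ F) : Space θ hθ F) - z‖ = 2 := by
    rw [coe_neg_sphere, ← neg_add', norm_neg, ← two_smul ℝ, norm_smul, norm_coe_sphere]
    norm_num
  rw [← norm_map_sub U, hz, U.apply_symm_apply, norm_sub_vertex_eq_two_iff] at hnorm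
  have := coord_eq_neg_of_coord_map_eq_neg hτ U hσ h hnorm
  rwa [coe_neg_sphere, map_neg, neg_inj] at this

theorem coord_map_eq_neg_iff (U : Sphere θ hθ F ≃ᵢ Sphere θ hθ F) (hσ : |σ| = 1)
    (h : coord j (U (vertex τ hτ i) : Space θ hθ F) = σ) (y : Sphere θ hθ F) :
    coord j (U y : Space θ hθ F) = -σ ↔ coord i (y : Space θ hθ F) = -τ := by
  refine ⟨coord_eq_neg_of_coord_map_eq_neg hτ U hσ h, fun hy => ?_⟩
  refine coord_eq_neg_of_coord_map_eq_neg hσ U.symm hτ (coord_symm_vertex_eq hτ hσ U h) ?_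
  rwa [U.symm_apply_apply]

theorem coord_map_eq_iff (U : Sphere θ hθ F ≃ᵢ Sphere θ hθ F) (hσ : |σ| = 1)
    (h : coord j (U (vertex τ hτ i) : Space θ hθ F) = σ) (y : Sphere θ hθ F) :
    coord j (U y : Space θ hθ F) = σ ↔ coord i (y : Space θ hθ F) = τ := by
  have hneg := (coord_map_eq_neg_iff hτ U hσ h _).2 (coord_vertex_self (abs_neg_eq_one hτ) i)
  simpa only [neg_neg] using coord_map_eq_neg_iff (abs_neg_eq_one hτ) U (abs_neg_eq_one hσ) hneg y

variable (θ hθ F) in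
/-- The face of the unit sphere on which the `i`-th coordinate equals `s`. -/
abbrev Face (i : ℕ+) (s : ℝ) : Type := {y : Sphere θ hθ F // coord i (y : Space θ hθ F) = s}

theorem norm_two_mul_smul_unitVec_sub {y : Space θ hθ F} (hy : coord i y = τ) :
    ‖(2 * τ) • unitVec θ hθ F i - y‖ = ‖y‖ := by
  have h : ∀ k, |coord k ((2 * τ) • unitVec θ hθ F i - y)| = |coord k y| := by
    intro k
    rw [map_sub, map_smul, coord_unitVec, smul_eq_mul]
    split_ifs with hk
    · rw [hk, hy, mul_one, two_mul, add_sub_cancel_right]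
    · rw [mul_zero, zero_sub, abs_neg]
  exact le_antisymm (norm_le_of_abs_coord_le fun k => (h k).le)
    (norm_le_of_abs_coord_le fun k => (h k).ge)

/-- The reflection of a face in its centre. -/
def reflectFace (i : ℕ+) (s : ℝ) : Face θ hθ F i s ≃ᵢ Face θ hθ F i s :=
  let f : Face θ hθ F i s → Face θ hθ F i s := fun y =>
    ⟨⟨(2 * s) • unitVec θ hθ F i - (y.1 : Space θ hθ F), by
      rw [mem_sphere_zero_iff_norm, norm_two_mul_smul_unitVec_sub y.2, norm_coe_sphere]⟩, by
      rw [map_sub, map_smul, coord_unitVec_self, y.2, smul_eq_mul]; ring⟩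
  IsometryEquiv.mk' f f
    (fun y => Subtype.ext (Subtype.ext (sub_sub_cancel _ _)))
    (Isometry.of_dist_eq fun x y => by
      simp only [Subtype.dist_eq]
      exact dist_sub_left _ _ _)

theorem coe_reflectFace (y : Face θ hθ F i τ) :
    ((reflectFace i τ y).1 : Space θ hθ F) = (2 * τ) • unitVec θ hθ F i - (y.1 : Space θ hθ F) :=
  rfl

/-- The centre of a face. -/
def faceCenter (i : ℕ+) (s : ℝ) (hs : |s| = 1) : Face θ hθ F i s :=
  ⟨vertex s hs i, coord_vertex_self hs i⟩

theorem dist_reflectFace (y : Face θ hθ F i τ) :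
    dist (reflectFace i τ y) y = 2 * dist y (faceCenter i τ hτ) := by
  have h : (2 * τ) • unitVec θ hθ F i - (y.1 : Space θ hθ F) - y.1 =
      (-2 : ℝ) • ((y.1 : Space θ hθ F) - τ • unitVec θ hθ F i) := by module
  simp only [Subtype.dist_eq, coe_reflectFace, dist_eq_norm, faceCenter, coe_vertex, h, norm_smul,
    norm_neg, RCLike.norm_ofNat]

theorem map_vertex (U : Sphere θ hθ F ≃ᵢ Sphere θ hθ F)
    (h : coord j (U (vertex τ hτ i) : Space θ hθ F) = σ) :
    U (vertex τ hτ i) = vertex σ hσ j := by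
  let g : Face θ hθ F i τ ≃ᵢ Face θ hθ F j σ :=
    ⟨U.toEquiv.subtypeEquiv fun y => (coord_map_eq_iff hτ U hσ h y).symm,
      fun x y => U.isometry x.1 y.1⟩
  have hbdd (y : Face θ hθ F i τ) : dist y (faceCenter i τ hτ) ≤ 2 := by
    simpa only [Subtype.dist_eq, dist_eq_norm] using norm_sub_sphere_le _ _
  exact congrArg Subtype.val (map_center_eq g (reflectFace i τ) (dist_reflectFace hτ) hbdd
    (reflectFace j σ) (dist_reflectFace hσ))

end Faces

theorem exists_tendsto_coord (hS : firstSchreier ⊆ F) {ι : Type*} (f : Ultrafilter ι)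
    (x : ι → Sphere θ hθ F) : ∃ w : Space θ hθ F, ∀ n,
      Tendsto (fun k => coord n (x k : Space θ hθ F)) f (𝓝 (coord n w)) := by
  have hlim : ∀ n, ∃ a : ℝ, Tendsto (fun k => coord n (x k : Space θ hθ F)) f (𝓝 a) := by
    intro n
    obtain ⟨a, -, ha⟩ := (isCompact_Icc (a := (-1 : ℝ)) (b := 1)).ultrafilter_le_nhds
      (f.map fun k => coord n (x k : Space θ hθ F)) (by
        rw [le_principal_iff, Ultrafilter.coe_map, mem_map]
        exact univ_mem' fun k => abs_le.1 (abs_coord_sphere_le n (x k)))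
    exact ⟨a, ha⟩
  choose a ha using hlim
  have hsum : Summable fun k => a k • unitVec θ hθ F k := by
    refine summable_of_bounded hS (C := 1) fun A => ?_
    have hA : Tendsto (fun k => restr A (x k : Space θ hθ F)) f
        (𝓝 (∑ k ∈ A, a k • unitVec θ hθ F k)) := by
      simp only [restr_apply]
      exact tendsto_finsetSum _ fun k _ => (ha k).smul_const _
    exact le_of_tendsto' hA.norm fun k => (norm_restr_le _ _).trans (norm_coe_sphere _).le
  refine ⟨∑' k, a k • unitVec θ hθ F k, fun n => ?_⟩
  rw [coord_eq_of_hasSum hsum.hasSum n]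
  exact ha n

section Vertices

variable {U : Sphere θ hθ F ≃ᵢ Sphere θ hθ F} {l : Filter ℕ+} {w : Space θ hθ F} {n N : ℕ+}

theorem exists_abs_sub_eq_one_add_abs {ι : Type*} (c : ι → ℝ) :
    ∃ a : ι → ℝ, (∀ k, |a k| = 1) ∧ ∀ k, |a k - c k| = 1 + |c k| := by
  suffices h : ∀ k, ∃ a : ℝ, |a| = 1 ∧ |a - c k| = 1 + |c k| by
    choose a ha hac using h
    exact ⟨a, ha, hac⟩
  intro k
  rcases le_total 0 (c k) with h | h
  · refine ⟨-1, abs_neg_eq_one abs_one, ?_⟩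
    rw [abs_of_nonneg h, abs_of_nonpos (by linarith)]
    ring
  · refine ⟨1, abs_one, ?_⟩
    rw [abs_of_nonpos h, abs_of_nonneg (by linarith), sub_eq_add_neg]

theorem eventually_norm_sub_vertex_le (hl : l ≤ cofinite) (z : Sphere θ hθ F) :
    ∀ᶠ k in l, ‖(z : Space θ hθ F) - (vertex 1 abs_one k : Sphere θ hθ F)‖ ≤ 1 + θ := by
  have hz := ((tendsto_coord_cofinite (z : Space θ hθ F)).mono_left hl).eventually_mem
    (Icc_mem_nhds (neg_lt_zero.2 hθ.1) hθ.1)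
  filter_upwards [hz] with k hk
  rw [coe_vertex, sub_eq_add_neg, ← neg_smul]
  refine (norm_add_smul_unitVec_le _ _ _).trans (max_le ?_ ?_)
  · rw [abs_le]
    constructor <;> linarith [hk.1, hk.2, hθ.2]
  · rw [norm_coe_sphere, abs_neg, abs_one]
    linarith

section LimitOfVertexImages

variable [l.NeBot]

theorem norm_map_vertex_sub_le (hl : l ≤ cofinite)
    (hw : ∀ n, Tendsto (fun k => coord n (U (vertex 1 abs_one k) : Space θ hθ F)) l
      (𝓝 (coord n w))) {s : ℝ} (hs : |s| = 1) (i : ℕ+) :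
    ‖(U (vertex s hs i) : Space θ hθ F) - w‖ ≤ 1 := by
  refine norm_le_of_tendsto_coord (l := l)
    (x := fun k => (U (vertex s hs i) : Space θ hθ F) - (U (vertex 1 abs_one k) : Space θ hθ F))
    (fun n => ?_) ?_
  · simp only [map_sub]
    exact (hw n).const_sub _
  · filter_upwards [hl (Set.finite_singleton i).eventually_cofinite_notMem] with k hk
    rw [norm_map_sub, norm_vertex_sub_vertex _ _ (Ne.symm hk)]

theorem norm_map_vertex_sub (hl : l ≤ cofinite)
    (hw : ∀ n, Tendsto (fun k => coord n (U (vertex 1 abs_one k) : Space θ hθ F)) l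
      (𝓝 (coord n w))) {s : ℝ} (hs : |s| = 1) (i : ℕ+) :
    ‖(U (vertex s hs i) : Space θ hθ F) - w‖ = 1 := by
  refine le_antisymm (norm_map_vertex_sub_le hl hw hs i) ?_
  have hneg := norm_map_vertex_sub_le hl hw (abs_neg_eq_one hs) i
  have htwo : ‖(U (vertex s hs i) : Space θ hθ F) - U (vertex (-s) (abs_neg_eq_one hs) i)‖ = 2 := by
    rw [norm_map_sub]
    exact norm_sub_eq_two hs (coord_vertex_self hs i) (coord_vertex_self _ i)
  have := norm_sub_le_norm_sub_add_norm_sub (U (vertex s hs i) : Space θ hθ F) w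
    (U (vertex (-s) (abs_neg_eq_one hs) i))
  rw [htwo, norm_sub_rev w] at this
  linarith

theorem exists_abs_coord_map_vertex_sub_eq_one (hF : HereditarySpreading F) (hl : l ≤ cofinite)
    (hw : ∀ n, Tendsto (fun k => coord n (U (vertex 1 abs_one k) : Space θ hθ F)) l
      (𝓝 (coord n w))) (i : ℕ+) :
    ∃ j, |coord j ((U (vertex 1 abs_one i) : Space θ hθ F) - w)| = 1 := by
  refine exists_abs_coord_eq_one_of_norm_sub_le hF (norm_map_vertex_sub hl hw abs_one) (l := l)
    (fun n => ?_) (norm_map_vertex_sub hl hw abs_one i) ?_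
  · simpa only [map_sub, sub_self] using (hw n).sub_const (coord n w)
  · filter_upwards [hl (Set.finite_singleton i).eventually_cofinite_notMem] with k hk
    rw [sub_sub_sub_cancel_right, norm_map_sub, norm_vertex_sub_vertex _ _ (Ne.symm hk)]

/-- A sum of `N` unit vectors of signs opposite to those of `w` lies on the sphere, hence within
`1 + θ` of most images of vertices; by admissibility this leaves no room for coordinates of `w`. -/
theorem coord_limit_eq_zero_of_admissible (hF : HereditarySpreading F) (hN : θ * (N : ℝ) = 1)
    (hl : l ≤ cofinite)
    (hw : ∀ n, Tendsto (fun k => coord n (U (vertex 1 abs_one k) : Space θ hθ F)) l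
      (𝓝 (coord n w))) {g : Fin (N + 1) → ℕ+} (hg : StrictMono g)
    (hgF : Finset.univ.image g ∈ F) (i : Fin N) : coord (g i.castSucc) w = 0 := by
  obtain ⟨a, ha, haw⟩ := exists_abs_sub_eq_one_add_abs fun k => coord k w
  let A := Finset.univ.image fun i : Fin N => g i.castSucc
  have hA : A.card = N :=
    (Finset.card_image_of_injective _ (hg.injective.comp (Fin.castSucc_injective _))).trans
      (Finset.card_fin _)
  have hgA (i : Fin N) : g i.castSucc ∈ A := Finset.mem_image_of_mem _ (Finset.mem_univ i)
  set q : Space θ hθ F := ∑ k ∈ A, a k • unitVec θ hθ F k with hqdef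
  have hq : ‖q‖ = 1 := by
    refine le_antisymm (norm_sum_smul_le zero_le_one (fun k _ => (ha k).le) ?_) ?_
    · simp only [ha, Finset.sum_const, hA, nsmul_eq_mul, mul_one]
      exact hN.le
    · have := abs_coord_le (g i.castSucc) q
      rwa [hqdef, coord_sum_smul, if_pos (hgA _), ha] at this
  have hnear : ∀ᶠ k in l, ‖q - w - ((U (vertex 1 abs_one k) : Space θ hθ F) - w)‖ ≤ 1 + θ := by
    filter_upwards [eventually_norm_sub_vertex_le hl
      (U.symm ⟨q, mem_sphere_zero_iff_norm.2 hq⟩)] with k hk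
    rwa [← norm_map_sub U, U.apply_symm_apply, ← sub_sub_sub_cancel_right _ _ w] at hk
  have hsum := sum_restr_add_one_le_of_eventually_norm_sub_le hF
    (norm_map_vertex_sub hl hw abs_one)
    (fun n => by simpa only [map_sub, sub_self] using (hw n).sub_const (coord n w))
    (admissible_singleton hg hgF) hnear
  have hcoord (i : Fin N) : ‖restr {g i.castSucc} (q - w)‖ = 1 + |coord (g i.castSucc) w| := by
    rw [restr_apply, Finset.sum_singleton, norm_smul_unitVec, map_sub, hqdef, coord_sum_smul,
      if_pos (hgA i), haw]
  simp only [hcoord, Finset.sum_add_distrib, Finset.sum_const, Finset.card_fin, nsmul_eq_mul,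
    mul_one] at hsum
  have hle : θ * ∑ i : Fin N, |coord (g i.castSucc) w| ≤ θ * 0 := by linarith
  have hsingle := Finset.single_le_sum (f := fun i : Fin N => |coord (g i.castSucc) w|)
    (fun _ _ => abs_nonneg _) (Finset.mem_univ i)
  exact abs_nonpos_iff.1 (hsingle.trans (le_of_mul_le_mul_left hle hθ.1))

theorem coord_limit_eq_zero (hF : HereditarySpreading F) (hS : firstSchreier ⊆ F)
    (hN : θ * (N : ℝ) = 1) (hl : l ≤ cofinite)
    (hw : ∀ n, Tendsto (fun k => coord n (U (vertex 1 abs_one k) : Space θ hθ F)) l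
      (𝓝 (coord n w))) (hn : N < n) : coord n w = 0 := by
  let g : Fin (N + 1) → ℕ+ := fun i => ⟨n + i, Nat.add_pos_left n.pos i⟩
  have hg : StrictMono g := fun i j hij => Nat.add_lt_add_left (n := (i : ℕ)) hij n
  refine coord_limit_eq_zero_of_admissible hF hN hl hw hg (hS fun k hk => ?_) ⟨0, N.pos⟩
  obtain ⟨i, -, rfl⟩ := Finset.mem_image.1 hk
  refine (Finset.card_image_le.trans_eq (Finset.card_fin _)).trans ?_
  exact (Nat.succ_le_of_lt hn).trans (Nat.le_add_right _ _)

end LimitOfVertexImages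

theorem eventually_exists_abs_coord_map_vertex_eq_one (hF : HereditarySpreading F)
    (hS : firstSchreier ⊆ F) (hN : θ * (N : ℝ) = 1) (U : Sphere θ hθ F ≃ᵢ Sphere θ hθ F) :
    ∀ᶠ k in hyperfilter ℕ+, ∃ j, |coord j (U (vertex 1 abs_one k) : Space θ hθ F)| = 1 := by
  obtain ⟨w, hw⟩ := exists_tendsto_coord hS (hyperfilter ℕ+) fun k => U (vertex 1 abs_one k)
  have hsmall : ∀ᶠ k in hyperfilter ℕ+, ∀ n ∈ Finset.Icc 1 N,
      |coord n ((U (vertex 1 abs_one k) : Space θ hθ F) - w)| < 1 := by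
    rw [eventually_all_finset]
    intro n _
    simp only [map_sub]
    exact ((hw n).sub_const (coord n w)).abs.eventually_lt_const
      (by rw [sub_self, abs_zero]; exact one_pos)
  filter_upwards [hsmall] with k hk
  obtain ⟨j, hj⟩ := exists_abs_coord_map_vertex_sub_eq_one hF hyperfilter_le_cofinite hw k
  have hNj : N < j := by
    by_contra! h
    exact (hk j (Finset.mem_Icc.2 ⟨one_le, h⟩)).ne hj
  refine ⟨j, ?_⟩
  rwa [map_sub, coord_limit_eq_zero hF hS hN hyperfilter_le_cofinite hw hNj, sub_zero] at hj

theorem eventually_norm_map_vertex_sub_le_one (hF : HereditarySpreading F)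
    (hS : firstSchreier ⊆ F) (hN : θ * (N : ℝ) = 1) (U : Sphere θ hθ F ≃ᵢ Sphere θ hθ F) {s : ℝ}
    (hs : |s| = 1) (k : ℕ+) : ∀ᶠ m in hyperfilter ℕ+,
      ‖(U (vertex s hs k) : Space θ hθ F) - (vertex 1 abs_one m : Sphere θ hθ F)‖ ≤ 1 := by
  have hfar (t : ℝ) (ht : |t| = 1) :
      ∀ᶠ m in hyperfilter ℕ+, U (vertex t ht k) ≠ vertex 1 abs_one m := by
    filter_upwards [((tendsto_coord_cofinite (U (vertex t ht k) : Space θ hθ F)).mono_left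
      hyperfilter_le_cofinite).eventually_ne zero_ne_one] with m hm h
    exact hm (by rw [h, coord_vertex_self])
  filter_upwards [eventually_exists_abs_coord_map_vertex_eq_one hF hS hN U.symm, hfar 1 abs_one,
    hfar (-1) (abs_neg_eq_one abs_one)] with m ⟨j, hj⟩ hpos hneg
  have hUj : U (vertex _ hj j) = vertex 1 abs_one m := by
    rw [← map_vertex abs_one hj U.symm rfl, U.apply_symm_apply]
  have hjk : k ≠ j := by
    rintro rfl
    rcases (abs_eq zero_le_one).1 hj with h | h <;> simp only [h] at hUj
    exacts [hpos hUj, hneg hUj]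
  rw [← hUj, norm_map_sub, norm_vertex_sub_vertex _ _ hjk]

theorem exists_map_vertex_eq (hF : HereditarySpreading F) (hS : firstSchreier ⊆ F)
    (hN : θ * (N : ℝ) = 1) (U : Sphere θ hθ F ≃ᵢ Sphere θ hθ F) {s : ℝ} (hs : |s| = 1) (k : ℕ+) :
    ∃ (j : ℕ+) (σ : ℝ) (hσ : |σ| = 1), U (vertex s hs k) = vertex σ hσ j := by
  have hnull (n : ℕ+) : Tendsto (fun m => coord n ((vertex 1 abs_one m : Sphere θ hθ F) :
      Space θ hθ F)) (hyperfilter ℕ+) (𝓝 0) := by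
    refine tendsto_nhds_of_eventually_eq ?_
    filter_upwards [hyperfilter_le_cofinite
      (Set.finite_singleton n).eventually_cofinite_notMem] with m hm
    rw [coord_vertex, if_neg (Ne.symm hm)]
  obtain ⟨j, hj⟩ := exists_abs_coord_eq_one_of_norm_sub_le hF (fun m => norm_coe_sphere _) hnull
    (norm_coe_sphere _) (eventually_norm_map_vertex_sub_le_one hF hS hN U hs k)
  exact ⟨j, _, hj, map_vertex hs hj U rfl⟩

end Vertices

end Sphere

/-! ### Isometries of the unit sphere permute coordinates up to signs -/

section Rigidity

variable {θ : ℝ} {hθ : θ ∈ Set.Ioc (0 : ℝ) (1 / 2)} {F : Set (Finset ℕ+)}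

theorem mul_self_of_abs_eq_one {s : ℝ} (hs : |s| = 1) : s * s = 1 := by
  rw [← abs_mul_abs_self, hs, one_mul]

/-- The witness is obtained from `y` by setting the `i`-th coordinate to `-τ` and multiplying the
others by `1 - θ`. -/
theorem exists_coord_eq_neg_norm_sub_le {i : ℕ+} {τ : ℝ} (hτ : |τ| = 1) (y : Sphere θ hθ F) :
    ∃ z : Sphere θ hθ F, coord i (z : Space θ hθ F) = -τ ∧
      ‖(y : Space θ hθ F) - z‖ ≤ 1 + max 0 (τ * coord i (y : Space θ hθ F)) := by
  have hθ0 := hθ.1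
  have hθ2 := hθ.2
  set c := coord i (y : Space θ hθ F)
  set v : Space θ hθ F := y - restr {i} (y : Space θ hθ F) with hv
  have hvi : coord i v = 0 := by
    rw [hv, map_sub, coord_restr, if_pos (Finset.mem_singleton_self i), sub_self]
  have hvnorm : ‖v‖ ≤ 1 := (norm_sub_restr_le {i} _).trans_eq (norm_coe_sphere y)
  set z : Space θ hθ F := (1 - θ) • v + (-τ) • unitVec θ hθ F i with hz
  have hzi : coord i z = -τ := by
    rw [hz, map_add, map_smul, map_smul, hvi, coord_unitVec_self, smul_zero, zero_add, smul_eq_mul,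
      mul_one]
  have hznorm : ‖z‖ = 1 := by
    refine le_antisymm ((norm_add_smul_unitVec_le _ _ _).trans (max_le ?_ ?_)) ?_
    · rw [map_smul, hvi, smul_zero, zero_add, abs_neg, hτ]
    · rw [norm_smul, abs_neg, hτ, Real.norm_eq_abs, abs_of_nonneg (by linarith)]
      nlinarith
    · simpa only [hzi, abs_neg, hτ] using abs_coord_le i z
  refine ⟨⟨z, mem_sphere_zero_iff_norm.2 hznorm⟩, hzi, ?_⟩
  have hyz : (y : Space θ hθ F) - z = θ • v + (c + τ) • unitVec θ hθ F i := by
    rw [hz, hv, restr_apply, Finset.sum_singleton]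
    module
  have habs : |c + τ| = 1 + τ * c := by
    have hτc : |τ * c| ≤ 1 := by
      rw [abs_mul, hτ, one_mul]
      exact abs_coord_sphere_le i y
    calc |c + τ| = |τ * (c + τ)| := by rw [abs_mul, hτ, one_mul]
      _ = |1 + τ * c| := by rw [mul_add, mul_self_of_abs_eq_one hτ, add_comm]
      _ = 1 + τ * c := abs_of_nonneg (by linarith [(abs_le.1 hτc).1])
  rw [hyz]
  refine (norm_add_smul_unitVec_le _ _ _).trans ?_
  rw [map_smul, hvi, smul_zero, zero_add, habs, norm_smul, Real.norm_eq_abs, abs_of_pos hθ0]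
  have hmax0 := le_max_left 0 (τ * c)
  have hmax := le_max_right 0 (τ * c)
  exact max_le (by linarith) (by nlinarith [habs ▸ abs_nonneg (c + τ)])

theorem mul_coord_map_le (U : Sphere θ hθ F ≃ᵢ Sphere θ hθ F) {i j : ℕ+} {τ σ : ℝ}
    (hτ : |τ| = 1) (hσ : |σ| = 1) (h : coord j (U (vertex τ hτ i) : Space θ hθ F) = σ)
    (y : Sphere θ hθ F) :
    σ * coord j (U y : Space θ hθ F) ≤ max 0 (τ * coord i (y : Space θ hθ F)) := by
  obtain ⟨z, hzi, hyz⟩ := exists_coord_eq_neg_norm_sub_le hτ (i := i) y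
  have hcoord := abs_coord_le j ((U y : Space θ hθ F) - (U z : Space θ hθ F))
  rw [map_sub, (coord_map_eq_neg_iff hτ U hσ h z).2 hzi, sub_neg_eq_add, norm_map_sub] at hcoord
  have hle : σ * coord j (U y : Space θ hθ F) + 1 ≤ |coord j (U y : Space θ hθ F) + σ| := by
    calc σ * coord j (U y : Space θ hθ F) + 1 = σ * (coord j (U y : Space θ hθ F) + σ) := by
          rw [mul_add, mul_self_of_abs_eq_one hσ]
      _ ≤ |σ * (coord j (U y : Space θ hθ F) + σ)| := le_abs_self _
      _ = |coord j (U y : Space θ hθ F) + σ| := by rw [abs_mul, hσ, one_mul]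
  linarith

theorem mul_coord_map_eq (U : Sphere θ hθ F ≃ᵢ Sphere θ hθ F) {i j : ℕ+} {τ σ : ℝ}
    (hτ : |τ| = 1) (hσ : |σ| = 1) (h : U (vertex τ hτ i) = vertex σ hσ j) (y : Sphere θ hθ F) :
    σ * coord j (U y : Space θ hθ F) = τ * coord i (y : Space θ hθ F) := by
  have hτ' := abs_neg_eq_one hτ
  have hσ' := abs_neg_eq_one hσ
  have hpos : coord j (U (vertex τ hτ i) : Space θ hθ F) = σ := by rw [h, coord_vertex_self]
  have hneg : coord j (U (vertex (-τ) hτ' i) : Space θ hθ F) = -σ :=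
    (coord_map_eq_neg_iff hτ U hσ hpos _).2 (coord_vertex_self hτ' i)
  have hle := mul_coord_map_le U hτ hσ hpos y
  have hle_neg := mul_coord_map_le U hτ' hσ' hneg y
  have hge := mul_coord_map_le U.symm hσ hτ (coord_symm_vertex_eq hτ hσ U hpos) (U y)
  have hge_neg := mul_coord_map_le U.symm hσ' hτ' (coord_symm_vertex_eq hτ' hσ' U hneg) (U y)
  simp only [U.symm_apply_apply, neg_mul] at hle_neg hge hge_neg
  rcases le_total 0 (τ * coord i (y : Space θ hθ F)) with h0 | h0
  · rw [max_eq_right h0] at hle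
    rw [max_eq_left (by linarith)] at hle_neg
    rw [max_eq_right (by linarith)] at hge
    linarith
  · rw [max_eq_left h0] at hle
    rw [max_eq_right (by linarith)] at hle_neg
    rw [max_eq_right (by linarith)] at hge_neg
    linarith

theorem exists_perm_coord_map (hF : HereditarySpreading F) (hS : firstSchreier ⊆ F) {N : ℕ+}
    (hN : θ * (N : ℝ) = 1) (U : Sphere θ hθ F ≃ᵢ Sphere θ hθ F) :
    ∃ (ε : ℕ+ → ℝ) (π : Equiv.Perm ℕ+), (∀ i, |ε i| = 1) ∧ ∀ (y : Sphere θ hθ F) (i : ℕ+),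
      coord (π i) (U y : Space θ hθ F) = ε i * coord i (y : Space θ hθ F) := by
  choose p ε hε hp using fun i => exists_map_vertex_eq hF hS hN U abs_one i
  have hcoord (y : Sphere θ hθ F) (i : ℕ+) :
      coord (p i) (U y : Space θ hθ F) = ε i * coord i (y : Space θ hθ F) := by
    have h := mul_coord_map_eq U abs_one (hε i) (hp i) y
    calc coord (p i) (U y : Space θ hθ F) = ε i * ε i * coord (p i) (U y : Space θ hθ F) := by
          rw [mul_self_of_abs_eq_one (hε i), one_mul]
      _ = ε i * coord i (y : Space θ hθ F) := by rw [mul_assoc, h, one_mul]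
  have hinj : Function.Injective p := by
    intro i j hij
    by_contra hne
    have h := hcoord (vertex 1 abs_one i) j
    rw [coord_vertex, if_neg (Ne.symm hne), mul_zero, ← hij, hp, coord_vertex_self] at h
    exact one_ne_zero (by rw [← hε i, h, abs_zero])
  have hsurj : Function.Surjective p := by
    intro j
    obtain ⟨i, σ, hσ, hi⟩ := exists_map_vertex_eq hF hS hN U.symm abs_one j
    refine ⟨i, ?_⟩
    by_contra hne
    have h := hcoord (vertex σ hσ i) i
    rw [← hi, U.apply_symm_apply, hi, coord_vertex, coord_vertex_self, if_neg hne] at h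
    exact zero_ne_one (by rw [← abs_zero (α := ℝ), h, abs_mul, hε, hσ, one_mul])
  exact ⟨ε, Equiv.ofBijective p ⟨hinj, hsurj⟩, hε, hcoord⟩

theorem exists_sphere_eq_norm_smul (x : Space θ hθ F) :
    ∃ z : Sphere θ hθ F, x = ‖x‖ • (z : Space θ hθ F) := by
  rcases eq_or_ne x 0 with rfl | hx
  · exact ⟨vertex 1 abs_one 1, by rw [norm_zero, zero_smul]⟩
  · have hx' := norm_ne_zero_iff.2 hx
    exact ⟨⟨‖x‖⁻¹ • x, by rw [mem_sphere_zero_iff_norm, norm_smul, norm_inv, norm_norm,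
      inv_mul_cancel₀ hx']⟩, (smul_inv_smul₀ hx' x).symm⟩

theorem exists_linearIsometryEquiv (U : Sphere θ hθ F ≃ᵢ Sphere θ hθ F) {ε : ℕ+ → ℝ}
    {π : Equiv.Perm ℕ+} (hU : ∀ (y : Sphere θ hθ F) (i : ℕ+),
      coord (π i) (U y : Space θ hθ F) = ε i * coord i (y : Space θ hθ F)) :
    ∃ V : Space θ hθ F ≃ₗᵢ[ℝ] Space θ hθ F, (∀ x : Sphere θ hθ F, V x = (U x : Space θ hθ F)) ∧
      ∀ (x : Space θ hθ F) (i : ℕ+), coord (π i) (V x) = ε i * coord i x := by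
  have hext {x y : Space θ hθ F} (h : ∀ i, coord (π i) x = coord (π i) y) : x = y :=
    ext_coord fun k => by simpa only [π.apply_symm_apply] using h (π.symm k)
  have hex (x : Space θ hθ F) :
      ∃ y : Space θ hθ F, ‖y‖ = ‖x‖ ∧ ∀ i, coord (π i) y = ε i * coord i x := by
    obtain ⟨z, hz⟩ := exists_sphere_eq_norm_smul x
    refine ⟨‖x‖ • (U z : Space θ hθ F), ?_, fun i => ?_⟩
    · rw [norm_smul, norm_coe_sphere, norm_norm, mul_one]
    · conv_rhs => rw [hz]
      rw [map_smul, map_smul, hU, smul_eq_mul, smul_eq_mul, mul_left_comm]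
  choose V hVnorm hV using hex
  let VL : Space θ hθ F →ₗᵢ[ℝ] Space θ hθ F :=
    { toFun := V
      map_add' := fun x y => hext fun i => by simp only [map_add, hV, mul_add]
      map_smul' := fun c x => hext fun i => by
        simp only [RingHom.id_apply, map_smul, hV, smul_eq_mul, mul_left_comm]
      norm_map' := hVnorm }
  have hVU (x : Sphere θ hθ F) : V x = (U x : Space θ hθ F) := hext fun i => by rw [hV, hU]
  have hsurj : Function.Surjective VL := by
    intro y
    obtain ⟨z, hz⟩ := exists_sphere_eq_norm_smul y
    refine ⟨‖y‖ • (U.symm z : Space θ hθ F), ?_⟩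
    conv_rhs => rw [hz, ← U.apply_symm_apply z, ← hVU]
    exact map_smul VL _ _
  exact ⟨LinearIsometryEquiv.ofSurjective VL hsurj, hVU, hV⟩

end Rigidity

/-! ### Norms of indicator vectors detect the family -/

section Indicator

variable {d : ℕ} {E : Fin d → Finset ℕ+}

theorem Consecutive.sum_card_inter (hE : Consecutive E) (A : Finset ℕ+) :
    ∑ i, (E i ∩ A).card = (Finset.univ.biUnion E ∩ A).card := by
  rw [Finset.biUnion_inter, Finset.card_biUnion]
  intro i _ j _ hij
  refine Finset.disjoint_left.2 fun a hi hj => hij ?_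
  exact hE.eq_of_mem (Finset.mem_inter.1 hi).1 (Finset.mem_inter.1 hj).1

theorem HereditarySpreading.mem_of_subset_biUnion {F : Set (Finset ℕ+)}
    (hF : HereditarySpreading F) (hE : Admissible F E) {A : Finset ℕ+}
    (hA : A ⊆ Finset.univ.biUnion E) (hcard : ∀ i, (E i ∩ A).card ≤ 1) : A ∈ F := by
  obtain ⟨hcons, hmin⟩ := hE
  have hcover : ∀ a ∈ A, ∃ m, ∃ i, a ∈ E i ∧ (E i).min' (hcons.nonempty i) = m := fun a ha => by
    obtain ⟨i, -, hi⟩ := Finset.mem_biUnion.1 (hA ha)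
    exact ⟨_, i, hi, rfl⟩
  choose! m hm using hcover
  refine hF m hmin ?_ fun a ha => ?_
  · intro a ha b hb hab
    obtain ⟨i, hi, hmi⟩ := hm a ha
    obtain ⟨j, hj, hmj⟩ := hm b hb
    have hij : i < j := by
      rcases lt_trichotomy i j with h | rfl | h
      · exact h
      · exact absurd (Finset.card_le_one.1 (hcard i) a (Finset.mem_inter.2 ⟨hi, ha⟩) b
          (Finset.mem_inter.2 ⟨hj, hb⟩)) hab.ne
      · exact absurd (hcons.before _ _ h b hj a hi) hab.not_gt
    rw [← hmi, ← hmj]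
    exact hcons.before _ _ hij _ (Finset.min'_mem _ _) _ (Finset.min'_mem _ _)
  · obtain ⟨i, hi, hmi⟩ := hm a ha
    rw [← hmi]
    exact ⟨Finset.min'_le _ _ hi, Finset.mem_image_of_mem _ (Finset.mem_univ i)⟩

variable {θ : ℝ} {hθ : θ ∈ Set.Ioc (0 : ℝ) (1 / 2)} {F : Set (Finset ℕ+)} {A : Finset ℕ+}

variable (θ hθ F) in
/-- The vector `1_A = ∑ k ∈ A, e_k`. -/
def indicatorVec (A : Finset ℕ+) : Space θ hθ F := ∑ k ∈ A, unitVec θ hθ F k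

theorem coord_indicatorVec (A : Finset ℕ+) (k : ℕ+) :
    coord k (indicatorVec θ hθ F A) = if k ∈ A then 1 else 0 := by
  simpa only [indicatorVec, Pi.one_apply, one_smul] using
    coord_sum_smul (θ := θ) (hθ := hθ) (F := F) A 1 k

theorem restr_indicatorVec (E A : Finset ℕ+) :
    restr E (indicatorVec θ hθ F A) = indicatorVec θ hθ F (E ∩ A) :=
  ext_coord fun k => by
    simp only [coord_restr, coord_indicatorVec, Finset.mem_inter, ite_and]

theorem norm_indicatorVec_le {b : ℝ} (hb : 1 ≤ b) (hA : θ * A.card ≤ b) :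
    ‖indicatorVec θ hθ F A‖ ≤ b := by
  have h := norm_sum_smul_le (hθ := hθ) (F := F) (A := A) (a := 1) (zero_le_one.trans hb)
    (fun k _ => by rwa [Pi.one_apply, abs_one])
    (by simpa only [Pi.one_apply, abs_one, Finset.sum_const, nsmul_eq_mul, mul_one] using hA)
  simpa only [indicatorVec, Pi.one_apply, one_smul] using h

theorem norm_indicatorVec_le_card (A : Finset ℕ+) : ‖indicatorVec θ hθ F A‖ ≤ A.card :=
  (norm_sum_le _ _).trans_eq (by
    simp only [norm_unitVec, Finset.sum_const, nsmul_eq_mul, mul_one])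

theorem norm_indicatorVec_le_card_sub_one (hA : 2 ≤ A.card) :
    ‖indicatorVec θ hθ F A‖ ≤ A.card - 1 := by
  have hA' : (2 : ℝ) ≤ A.card := by exact_mod_cast hA
  exact norm_indicatorVec_le (by linarith) (by nlinarith [hθ.2])

theorem norm_indicatorVec_of_mem (hA : A ∈ F) (h1 : 1 ≤ θ * A.card) :
    ‖indicatorVec θ hθ F A‖ = θ * A.card := by
  refine le_antisymm (norm_indicatorVec_le h1 le_rfl) ?_
  have hadm : Admissible F fun i => {A.orderEmbOfFin rfl i} :=
    admissible_singleton (A.orderEmbOfFin rfl).strictMono (by rwa [Finset.image_orderEmbOfFin_univ])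
  have hsum := sum_restr_le (hθ := hθ) hadm (indicatorVec θ hθ F A)
  have hterm (i : Fin A.card) :
      restr {A.orderEmbOfFin rfl i} (indicatorVec θ hθ F A) =
        unitVec θ hθ F (A.orderEmbOfFin rfl i) := by
    rw [restr_indicatorVec, Finset.singleton_inter_of_mem (Finset.orderEmbOfFin_mem A rfl i),
      indicatorVec, Finset.sum_singleton]
  simpa only [hterm, norm_unitVec, Finset.sum_const, Finset.card_fin, nsmul_eq_mul, mul_one]
    using hsum

/-- Either some `E i` contains two elements of `A`, and `‖1_{E i ∩ A}‖` falls short of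
`|E i ∩ A|` by `1`, or the `E i` miss an element of `A`. -/
theorem sum_norm_restr_indicatorVec_le (hF : HereditarySpreading F) (hA : A ∉ F)
    (hE : Admissible F E) : ∑ i, ‖restr (E i) (indicatorVec θ hθ F A)‖ ≤ A.card - 1 := by
  simp only [restr_indicatorVec]
  have hcard : ∑ i, ((E i ∩ A).card : ℝ) = (Finset.univ.biUnion E ∩ A).card := by
    exact_mod_cast hE.1.sum_card_inter A
  by_cases htwo : ∃ i, 2 ≤ (E i ∩ A).card
  · obtain ⟨i, hi⟩ := htwo
    have hle : ((Finset.univ.biUnion E ∩ A).card : ℝ) ≤ A.card := by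
      exact_mod_cast Finset.card_le_card Finset.inter_subset_right
    calc ∑ j, ‖indicatorVec θ hθ F (E j ∩ A)‖
        ≤ ∑ j, (((E j ∩ A).card : ℝ) - if j = i then 1 else 0) := by
          refine Finset.sum_le_sum fun j _ => ?_
          split_ifs with hj
          · exact norm_indicatorVec_le_card_sub_one (hj ▸ hi)
          · simpa only [sub_zero] using norm_indicatorVec_le_card (E j ∩ A)
      _ = (Finset.univ.biUnion E ∩ A).card - 1 := by
          rw [Finset.sum_sub_distrib, hcard, Finset.sum_ite_eq' Finset.univ i,
            if_pos (Finset.mem_univ i)]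
      _ ≤ A.card - 1 := by linarith
  · push Not at htwo
    have hmiss : Finset.univ.biUnion E ∩ A ⊂ A := by
      refine Finset.ssubset_iff_subset_ne.2 ⟨Finset.inter_subset_right, fun h => hA ?_⟩
      exact hF.mem_of_subset_biUnion hE (Finset.inter_eq_right.1 h) fun i =>
        Nat.lt_succ_iff.1 (htwo i)
    have hlt : ((Finset.univ.biUnion E ∩ A).card : ℝ) + 1 ≤ A.card := by
      exact_mod_cast Finset.card_lt_card hmiss
    calc ∑ i, ‖indicatorVec θ hθ F (E i ∩ A)‖
        ≤ ∑ i, ((E i ∩ A).card : ℝ) := Finset.sum_le_sum fun i _ => norm_indicatorVec_le_card _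
      _ ≤ A.card - 1 := by linarith

theorem norm_indicatorVec_lt_of_notMem (hF : HereditarySpreading F) (hA : A ∉ F)
    (h1 : 1 < θ * A.card) : ‖indicatorVec θ hθ F A‖ < θ * A.card := by
  have hθ0 := hθ.1
  have hle : ‖indicatorVec θ hθ F A‖ ≤ max 1 (θ * (A.card - 1)) := by
    refine norm_le (fun k => le_max_of_le_left ?_) fun d E hE => le_max_of_le_right ?_
    · rw [coord_indicatorVec]
      split_ifs
      · rw [abs_one]
      · rw [abs_zero]
        exact zero_le_one
    · exact mul_le_mul_of_nonneg_left (sum_norm_restr_indicatorVec_le hF hA hE) hθ0.le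
  exact hle.trans_lt (max_lt h1 (by linarith))

theorem norm_indicatorVec_eq_iff (hF : HereditarySpreading F) (h1 : 1 < θ * A.card) :
    ‖indicatorVec θ hθ F A‖ = θ * A.card ↔ A ∈ F := by
  refine ⟨fun h => ?_, fun hA => norm_indicatorVec_of_mem hA h1.le⟩
  by_contra hA
  exact (norm_indicatorVec_lt_of_notMem hF hA h1).ne h

theorem norm_indicatorVec_image {ε : ℕ+ → ℝ} (hε : ∀ i, |ε i| = 1) {π : Equiv.Perm ℕ+}
    (V : Space θ hθ F ≃ₗᵢ[ℝ] Space θ hθ F)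
    (hV : ∀ (x : Space θ hθ F) (i : ℕ+), coord (π i) (V x) = ε i * coord i x) (A : Finset ℕ+) :
    ‖indicatorVec θ hθ F (A.image π)‖ = ‖indicatorVec θ hθ F A‖ := by
  have habs (k : ℕ+) : |coord k (indicatorVec θ hθ F (A.image π))| =
      |coord k (V (indicatorVec θ hθ F A))| := by
    obtain ⟨i, rfl⟩ := π.surjective k
    rw [hV, abs_mul, hε, one_mul, coord_indicatorVec, coord_indicatorVec]
    simp only [Finset.mem_image, EmbeddingLike.apply_eq_iff_eq, exists_eq_right]
  rw [← V.norm_map (indicatorVec θ hθ F A)]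
  exact le_antisymm (norm_le_of_abs_coord_le fun k => (habs k).le)
    (norm_le_of_abs_coord_le fun k => (habs k).ge)

theorem preservesLarge_of_coord_map (hF : HereditarySpreading F) {n : ℕ+}
    (hn : θ * (n : ℝ) = 1) {ε : ℕ+ → ℝ} (hε : ∀ i, |ε i| = 1) {π : Equiv.Perm ℕ+}
    (V : Space θ hθ F ≃ₗᵢ[ℝ] Space θ hθ F)
    (hV : ∀ (x : Space θ hθ F) (i : ℕ+), coord (π i) (V x) = ε i * coord i x) :
    PreservesLarge F n π := by
  intro A hA
  have hcard : (A.image π).card = A.card := Finset.card_image_of_injective A π.injective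
  have h1 : 1 < θ * A.card := hn ▸ mul_lt_mul_of_pos_left (by exact_mod_cast hA) hθ.1
  rw [← norm_indicatorVec_eq_iff (hθ := hθ) hF h1,
    ← norm_indicatorVec_eq_iff (hθ := hθ) hF (hcard.symm ▸ h1), hcard,
    norm_indicatorVec_image hε V hV]

end Indicator

section Extension

variable {θ : ℝ} {hθ : θ ∈ Set.Ioc (0 : ℝ) (1 / 2)} {F : Set (Finset ℕ+)}

theorem hasSum_of_coord_perm {ε : ℕ+ → ℝ} {π : Equiv.Perm ℕ+} {x y : Space θ hθ F}
    (hxy : ∀ i, coord (π i) y = ε i * coord i x) {a : ℕ+ → ℝ}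
    (hx : HasSum (fun i => a i • unitVec θ hθ F i) x) :
    HasSum (fun i => (ε i * a i) • unitVec θ hθ F (π i)) y := by
  have hcoord (i : ℕ+) : ε i * a i = coord (π i) y := by rw [hxy, coord_eq_of_hasSum hx]
  simp only [hcoord]
  exact π.hasSum_iff.2 (hasSum_coord y)

theorem exists_signs_perm_linearIsometryEquiv (hF : HereditarySpreading F)
    (hS : firstSchreier ⊆ F) {n : ℕ+} (hn : θ * (n : ℝ) = 1)
    (U : Sphere θ hθ F ≃ᵢ Sphere θ hθ F) :
    ∃ (ε : ℕ+ → ℝ) (π : Equiv.Perm ℕ+) (V : Space θ hθ F ≃ₗᵢ[ℝ] Space θ hθ F),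
      (∀ i, ε i = 1 ∨ ε i = -1) ∧ PreservesLarge F n π ∧
      (∀ x : Sphere θ hθ F, V x = (U x : Space θ hθ F)) ∧
      ∀ (x : Sphere θ hθ F) (a : ℕ+ → ℝ),
        HasSum (fun i => a i • unitVec θ hθ F i) (x : Space θ hθ F) →
        HasSum (fun i => (ε i * a i) • unitVec θ hθ F (π i)) (U x : Space θ hθ F) := by
  obtain ⟨ε, π, hε, hU⟩ := exists_perm_coord_map hF hS hn U
  obtain ⟨V, hVU, hV⟩ := exists_linearIsometryEquiv U hU
  refine ⟨ε, π, V, fun i => (abs_eq zero_le_one).1 (hε i),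
    preservesLarge_of_coord_map hF hn hε V hV, hVU,
    fun x a => hasSum_of_coord_perm (hU x)⟩

end Extension

end Tsirelson

end

theorem theoremB (θ : ℝ) (hθ : θ ∈ Set.Ioc (0 : ℝ) (1 / 2)) (N : ℕ) (hN : θ⁻¹ = (N : ℝ))
    (β : Ordinal.{0} → ℕ+ → Ordinal.{0}) (hβ : IsLadder β)
    (α : Ordinal.{0}) (hα1 : 1 ≤ α) (hα : α < ω₁)
    (U : Metric.sphere (0 : Space θ hθ (schreier β α)) 1 →
      Metric.sphere (0 : Space θ hθ (schreier β α)) 1)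
    (hU : Isometry U) (hU' : Function.Surjective U) :
    -- every vector has a unique expansion `∑ a_i e_i`
    (∀ x : Space θ hθ (schreier β α), ∃! a : ℕ+ → ℝ,
      HasSum (fun i => a i • unitVec θ hθ (schreier β α) i) x) ∧
    (α = 1 → ∃ (ε : ℕ+ → ℝ) (π : Equiv.Perm ℕ+), (∀ i, ε i = 1 ∨ ε i = -1) ∧
      (∀ i : ℕ+, N < (i : ℕ) → π i = i) ∧
      ∀ (x : Metric.sphere (0 : Space θ hθ (schreier β α)) 1) (a : ℕ+ → ℝ),
        HasSum (fun i => a i • unitVec θ hθ (schreier β α) i) (x : Space θ hθ (schreier β α)) →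
        HasSum (fun i => (ε i * a i) • unitVec θ hθ (schreier β α) (π i))
          (U x : Space θ hθ (schreier β α))) ∧
    (1 < α → ∃ ε : ℕ+ → ℝ, (∀ i, ε i = 1 ∨ ε i = -1) ∧
      ∀ (x : Metric.sphere (0 : Space θ hθ (schreier β α)) 1) (a : ℕ+ → ℝ),
        HasSum (fun i => a i • unitVec θ hθ (schreier β α) i) (x : Space θ hθ (schreier β α)) →
        HasSum (fun i => (ε i * a i) • unitVec θ hθ (schreier β α) i)
          (U x : Space θ hθ (schreier β α))) ∧
    -- `U` extends to a surjective linear isometry of the whole space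
    ∃ V : Space θ hθ (schreier β α) ≃ₗᵢ[ℝ] Space θ hθ (schreier β α),
      ∀ x : Metric.sphere (0 : Space θ hθ (schreier β α)) 1,
        V x = (U x : Space θ hθ (schreier β α)) := by
  have hθN : θ * N = 1 := by rw [← hN, mul_inv_cancel₀ hθ.1.ne']
  have hN0 : 0 < N := Nat.pos_of_ne_zero fun h => by simp [h] at hθN
  lift N to ℕ+ using hN0
  have hF := hereditarySpreading_schreier hβ hα
  have hS := firstSchreier_subset hβ hα1 hα
  obtain ⟨ε, π, V, hε, hπ, hVU, hsum⟩ := exists_signs_perm_linearIsometryEquiv hF hS hθN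
    ⟨Equiv.ofBijective U ⟨hU.injective, hU'⟩, hU⟩
  refine ⟨existsUnique_hasSum, ?_, ?_, V, hVU⟩
  · rintro rfl
    rw [schreier_one] at hπ
    exact ⟨ε, π, hε, fun i hi => hπ.apply_eq_of_lt hi, hsum⟩
  · intro h1
    obtain rfl := hπ.eq_refl_of_schreier hβ h1 hα
    exact ⟨ε, hε, hsum⟩
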